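/- Let $k$ be an algebraically closed field of characteristic $0$ or greater than $5$. Let $S = k[[\alpha_1,\alpha_2]]$ with maximal ideal $\mathfrak m$, and let $P = k_{dp}[x_1,x_2]$ be the divided power ring, regarded as the space of $k$-linear functionals on $S$ vanishing on some power of $\mathfrak m$, with basis $x^{[a]}$ dual to the monomials $\alpha^a$; let $P_{\le d}$ be the span of the $x^{[a]}$ with $|a|\le d$. For $f\in P$ let $\sigma\lrcorner f$ be the functional $\tau\mapsto f(\tau\sigma)$, and put $\operatorname{Ann}(f)=\{\sigma\in S : \sigma\lrcorner f=0\}$ and $\operatorname{Apolar}(f)=S/\operatorname{Ann}(f)$. The Hilbert function of a local $k$-algebra $(A,\mathfrak m_A)$ with residue field $k$ is $i\mapsto\dim_k\mathfrak m_A^i/\mathfrak m_A^{i+1}$, and $A$ is canonically graded if it is isomorphic, as a $k$-algebra, to $\bigoplus_i\mathfrak m_A^i/\mathfrak m_A^{i+1}$. Let $G^+$ be the group of $k$-linear automorphisms of $S$ generated by the $k$-algebra automorphisms $\varphi$ with $\varphi(\alpha_i)-\alpha_i\in\mathfrak m^2$ for all $i$ and by the multiplications by elements of $1+\mathfrak m$;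 it acts on functionals by precomposition. Let $f_5$ be the homogeneous part of degree $5$ of $f$. Let $U\subset P_{\le 5}$ be the set of those $f$ such that $\operatorname{Apolar}(f)$ is local with Hilbert function $(1,2,3,3,2,1)$ and no nonzero cubic form in $\operatorname{Ann}(f_5)$ is a power of a linear form. Then $U$ is a nonempty Zariski open subset of the affine space $P_{\le 5}$ (so a general $f \in P_{\le 5}$ belongs to $U$), and every $f\in U$ satisfies: 1. $f$ has degree exactly $5$, and both $\operatorname{Apolar}(f)$ and $\operatorname{Apolar}(f_5)$ have Hilbert function $(1,2,3,3,2,1)$; 2. $G^+\cdot f_5=f_5+P_{\le 4}$; 3. $\operatorname{Apolar}(f)\simeq\operatorname{Apolar}(f_5)$ as $k$-algebras, and $\operatorname{Apolar}(f)$ is canonically graded. -/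

import Mathlib

open MvPowerSeries

noncomputable section

namespace Macaulay

/-- The power series ring `S = k[[α₁, …, αₙ]]`. -/
abbrev PS (k : Type*) [Field k] (n : ℕ) : Type _ := MvPowerSeries (Fin n) k

/-- The maximal ideal `𝔪` of `S`. -/
abbrev maxIdeal (k : Type*) [Field k] (n : ℕ) : Ideal (PS k n) :=
  IsLocalRing.maximalIdeal (PS k n)

/-- The divided power monomial `x^[a]`: the functional on `S` dual to the monomial `α^a`. -/
def dpMonomial (k : Type*) [Field k] {n : ℕ} (a : Fin n →₀ ℕ) : Module.Dual k (PS k n) :=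
  MvPowerSeries.coeff a

/-- `P_{≤ d}`: divided power polynomials of degree at most `d`, that is, the span in the dual
space of `S` of the monomials `x^[a]` with `|a| ≤ d`. -/
def dpLE (k : Type*) [Field k] (n d : ℕ) : Submodule k (Module.Dual k (PS k n)) :=
  Submodule.span k {g | ∃ a : Fin n →₀ ℕ, a.degree ≤ d ∧ g = dpMonomial k a}

/-- The homogeneous part `f_d` of degree `d` of a divided power polynomial `f`: it pairs with `σ`
as `f` pairs with the degree `d` part of `σ`. -/
def homPart {k : Type*} [Field k] {n : ℕ} (d : ℕ) (f : Module.Dual k (PS k n)) :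
    Module.Dual k (PS k n) :=
  f ∘ₗ MvPowerSeries.homogeneousComponent d

/-- Contraction `σ ⌟ f`, given by `⟨τ, σ ⌟ f⟩ = ⟨τ σ, f⟩`. -/
def contract {k : Type*} [Field k] {n : ℕ} (σ : PS k n) (f : Module.Dual k (PS k n)) :
    Module.Dual k (PS k n) :=
  f ∘ₗ LinearMap.mulRight k σ

/-- The apolar ideal `Ann(f) = {σ | σ ⌟ f = 0}`. -/
def apolarIdeal {k : Type*} [Field k] {n : ℕ} (f : Module.Dual k (PS k n)) : Ideal (PS k n) where
  carrier := {σ | contract σ f = 0}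
  zero_mem' := by
    ext τ
    simp [contract]
  add_mem' := by
    intro a b ha hb
    ext τ
    have h1 := LinearMap.congr_fun ha τ
    have h2 := LinearMap.congr_fun hb τ
    simp only [contract, LinearMap.comp_apply, LinearMap.mulRight_apply,
      LinearMap.zero_apply] at h1 h2 ⊢
    rw [mul_add, map_add, h1, h2, add_zero]
  smul_mem' := by
    intro c a ha
    ext τ
    have h1 := LinearMap.congr_fun ha (τ * c)
    simp only [contract, LinearMap.comp_apply, LinearMap.mulRight_apply,
      LinearMap.zero_apply, smul_eq_mul] at h1 ⊢
    rw [← mul_assoc, h1]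

/-- The apolar algebra `Apolar(f) = S / Ann(f)`. -/
abbrev Apolar {k : Type*} [Field k] {n : ℕ} (f : Module.Dual k (PS k n)) : Type _ :=
  PS k n ⧸ apolarIdeal f

/-- The `k`-algebra `A` is local, and its Hilbert function `i ↦ dim_k 𝔪^i / 𝔪^(i+1)` is `H`. -/
def HasHilbertFunction (k A : Type*) [Field k] [CommRing A] [Algebra k A] (H : ℕ → ℕ) : Prop :=
  ∃ _ : IsLocalRing A, ∀ i : ℕ,
    Module.finrank k
      ((IsLocalRing.maximalIdeal A ^ i : Ideal A) ⧸
        (IsLocalRing.maximalIdeal A • ⊤ :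
          Submodule A (IsLocalRing.maximalIdeal A ^ i : Ideal A))) = H i

/-- The associated graded ring `gr_I(A) = ⨁ I^i / I^(i+1)`, as the Rees algebra of `I`
(which is `⨁ I^i t^i`) modulo the ideal generated by `I` (which is `⨁ I^(i+1) t^i`). -/
abbrev AssocGraded {A : Type*} [CommRing A] (I : Ideal A) : Type _ :=
  reesAlgebra I ⧸ I.map (algebraMap A (reesAlgebra I))

/-- The `k`-algebra `A` is local, and isomorphic to its associated graded algebra. -/
def IsCanonicallyGraded (k A : Type*) [Field k] [CommRing A] [Algebra k A] : Prop :=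
  ∃ _ : IsLocalRing A, Nonempty (A ≃ₐ[k] AssocGraded (IsLocalRing.maximalIdeal A))

/-- The group `G⁺ = Aut⁺(S) ⋉ (1 + 𝔪)`, inside the group of `k`-linear automorphisms of `S`. It is
generated by the `k`-algebra automorphisms `φ` of `S` with `φ(αᵢ) - αᵢ ∈ 𝔪²` for all `i`, and by
the multiplications by elements of `1 + 𝔪`. -/
def gPlus (k : Type*) [Field k] (n : ℕ) : Subgroup (PS k n ≃ₗ[k] PS k n) :=
  Subgroup.closure
    ({L | ∃ φ : PS k n ≃ₐ[k] PS k n,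
        (∀ i, φ (X i) - X i ∈ maxIdeal k n ^ 2) ∧ L = φ.toLinearEquiv} ∪
      {L | ∃ s : PS k n, s - 1 ∈ maxIdeal k n ∧ ∀ τ, L τ = s * τ})

/-- The orbit of `f` under `G⁺`, where `L` acts by the dual map: `⟨τ, L^∨ f⟩ = ⟨L τ, f⟩`. -/
def gPlusOrbit {k : Type*} [Field k] {n : ℕ} (f : Module.Dual k (PS k n)) :
    Set (Module.Dual k (PS k n)) :=
  {g | ∃ L ∈ gPlus k n, g = f ∘ₗ (L : PS k n →ₗ[k] PS k n)}

/-- A subset `U` of `P_{≤ d}` is Zariski open, for the affine space structure with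
coordinates the coefficients of the monomials `x^[a]`, `|a| ≤ d`. -/
def IsZariskiOpen {k : Type*} [Field k] {n d : ℕ} (U : Set (dpLE k n d)) : Prop :=
  ∃ J : Ideal (MvPolynomial {a : Fin n →₀ ℕ // a.degree ≤ d} k),
    ∀ f : dpLE k n d,
      f ∈ U ↔ (fun a => f.1 (monomial a.1 1)) ∉ MvPolynomial.zeroLocus k J

/-- The function with values `1, 2, 3, 3, 2, 1` at `0, …, 5`, and `0` afterwards. -/
def h123321 (i : ℕ) : ℕ := [1, 2, 3, 3, 2, 1].getD i 0

/-- No nonzero cubic form in `Ann(F)` is a power of a linear form. -/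
def CubicNotPower {k : Type*} [Field k] {n : ℕ} (F : Module.Dual k (PS k n)) : Prop :=
  ∀ c ∈ apolarIdeal F, c ≠ 0 → MvPowerSeries.homogeneousComponent 3 c = c →
    ∀ v : Fin n → k, c ≠ (∑ i, v i • (X i : PS k n)) ^ 3

end Macaulay

end

/-! Let `w` be the coefficients of f_5. The Hilbert function is (1,2,3,3,2,1) exactly when no
nonzero quadric kills f_5 (`NoQuadric`), that is, when the 3 × 4 Hankel matrix of `w` has rank 3.
The cubics in Ann(f_5) then form a line, spanned by the signed maximal minors `apolarCubic w`. Over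
an algebraically closed field with 3 invertible, a binary cubic is a cube exactly when its Hessian
vanishes. So U is the locus `hessian (apolarCubic w) ≠ 0`, which is open
(`hasHilbertFunction_and_cubicNotPower_iff`).

Elements of G⁺ act as the identity on each 𝔪^j/𝔪^(j+1), so the orbit of f_5 stays in f_5 + P_{≤4}.
To fill this space it suffices that every leading form of degree j ≤ 4 is a tangent direction
(`vanishing_le_tangentForms`); differences are then removed degree by degree (`gPlusOrbit_eq`).
Dually, a form σ of degree j orthogonal to the tangent directions kills f_5, and so do its two
partial derivatives. If j ≤ 2, then σ = 0 at once. If j = 3, the partials are quadrics, hence zero.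
If j = 4, both are multiples of the unique apolar cubic, and equality of mixed derivatives would
make that cubic a cube unless both vanish. As 2 and 3 are invertible, σ = 0.

Finally, G⁺ moves Ann only by algebra automorphisms, and Ann(f_5) is homogeneous, so Apolar(f) ≃
Apolar(f_5) is canonically graded (`apolar_of_mem_gPlusOrbit`). -/

namespace Macaulay

/-! ### Powers of the maximal ideal -/

theorem mem_maxIdeal_iff {k : Type*} [Field k] {n : ℕ} {σ : PS k n} :
    σ ∈ maxIdeal k n ↔ constantCoeff σ = 0 := by
  rw [IsLocalRing.mem_maximalIdeal, mem_nonunits_iff, MvPowerSeries.isUnit_iff_constantCoeff,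
    isUnit_iff_ne_zero, not_not]

theorem X_mem_maxIdeal (k : Type*) [Field k] {n : ℕ} (i : Fin n) : (X i : PS k n) ∈ maxIdeal k n :=
  mem_maxIdeal_iff.2 (by simp)

theorem le_order_of_mem_maxIdeal_pow {k : Type*} [Field k] {n e : ℕ} {σ : PS k n}
    (hσ : σ ∈ maxIdeal k n ^ e) : (e : ℕ∞) ≤ σ.order := by
  induction e generalizing σ with
  | zero => simp
  | succ e ih =>
    rw [pow_succ] at hσ
    refine Submodule.mul_induction_on hσ (fun a ha b hb => ?_) (fun a b ha hb => ?_)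
    · have h1 := ih ha
      have h2 : (1 : ℕ∞) ≤ b.order :=
        one_le_order_iff_constCoeff_eq_zero.2 (mem_maxIdeal_iff.1 hb)
      push_cast
      exact (add_le_add h1 h2).trans le_order_mul
    · exact (le_min ha hb).trans min_order_le_add

/-- The quotient of `σ` by `X i`, after discarding the monomials divisible by an earlier variable. -/
noncomputable def divVar {k : Type*} [Field k] {n : ℕ} (i : Fin n) (σ : PS k n) : PS k n :=
  open Classical in
  fun a => if ∀ j < i, a j = 0 then coeff (a + Finsupp.single i 1) σ else 0

theorem coeff_divVar {k : Type*} [Field k] {n : ℕ} (i : Fin n) (σ : PS k n) (a : Fin n →₀ ℕ)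
    [Decidable (∀ j < i, a j = 0)] :
    coeff a (divVar i σ) = if ∀ j < i, a j = 0 then coeff (a + Finsupp.single i 1) σ else 0 := by
  show divVar i σ a = _
  simp only [divVar]
  congr

/-- Each nonconstant monomial is charged to the first variable it contains, so it occurs in exactly
one summand. -/
theorem sum_X_mul_divVar {k : Type*} [Field k] {n : ℕ} {σ : PS k n} (hσ : constantCoeff σ = 0) :
    ∑ i, X i * divVar i σ = σ := by
  classical
  ext b
  rw [map_sum]
  by_cases hb : b = 0
  · subst hb
    simp [hσ, coeff_zero_eq_constantCoeff]
  · obtain ⟨i, hi, hmin⟩ : ∃ i, b i ≠ 0 ∧ ∀ j < i, b j = 0 := by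
      have hne : ∃ i, b i ≠ 0 := by
        by_contra! h
        exact hb (Finsupp.ext h)
      obtain ⟨i, hi⟩ := WellFounded.has_min (wellFounded_lt (α := Fin n)) {i | b i ≠ 0} hne
      exact ⟨i, hi.1, fun j hj => not_not.1 fun h => hi.2 j h hj⟩
    rw [Finset.sum_eq_single i]
    · rw [X, coeff_monomial_mul, if_pos, one_mul, coeff_divVar, if_pos, tsub_add_cancel_of_le]
      · simpa [Nat.one_le_iff_ne_zero] using hi
      · intro j hj
        simp [hmin j hj]
      · simpa [Nat.one_le_iff_ne_zero] using hi
    · intro j _ hj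
      rw [X, coeff_monomial_mul]
      split_ifs with hle
      · rw [one_mul, coeff_divVar, if_neg]
        intro hz
        rcases lt_or_gt_of_ne hj with h | h
        · have := hmin j h
          simp [this] at hle
        · have := hz i h
          simp [h.ne'] at this
          omega
      · rfl
    · simp

theorem mem_maxIdeal_pow_iff {k : Type*} [Field k] {n e : ℕ} {σ : PS k n} :
    σ ∈ maxIdeal k n ^ e ↔ ∀ a : Fin n →₀ ℕ, a.degree < e → coeff a σ = 0 := by
  classical
  refine ⟨fun h a ha => coeff_of_lt_order
    (lt_of_lt_of_le (by exact_mod_cast ha) (le_order_of_mem_maxIdeal_pow h)), fun h => ?_⟩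
  induction e generalizing σ with
  | zero => simp
  | succ e ih =>
    rw [← sum_X_mul_divVar (σ := σ) (by simpa using h 0 (by simp)), pow_succ']
    refine Ideal.sum_mem _ fun i _ => Ideal.mul_mem_mul (X_mem_maxIdeal k i) (ih fun a ha => ?_)
    rw [coeff_divVar]
    split_ifs
    · exact h _ (by simpa using ha)
    · rfl

theorem eq_of_sub_mem_maxIdeal_pow {k : Type*} [Field k] {n : ℕ} {σ τ : PS k n}
    (h : ∀ e, σ - τ ∈ maxIdeal k n ^ e) : σ = τ := by
  ext a
  have := mem_maxIdeal_pow_iff.1 (h (a.degree + 1)) a (Nat.lt_succ_self _)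
  rwa [map_sub, sub_eq_zero] at this

theorem monomial_mem_maxIdeal_pow {k : Type*} [Field k] {n e : ℕ} (a : Fin n →₀ ℕ) (c : k)
    (h : e ≤ a.degree) : (monomial a c : PS k n) ∈ maxIdeal k n ^ e := by
  classical
  rw [mem_maxIdeal_pow_iff]
  intro b hb
  rw [coeff_monomial, if_neg]
  rintro rfl
  omega

theorem sub_truncTotal_mem {k : Type*} [Field k] {n : ℕ} (σ : PS k n) (e : ℕ) :
    σ - (truncTotal e σ : MvPolynomial (Fin n) k) ∈ maxIdeal k n ^ e := by
  rw [mem_maxIdeal_pow_iff]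
  intro a ha
  rw [map_sub, MvPolynomial.coeff_coe, coeff_truncTotal _ ha, sub_self]

/-! ### Functionals vanishing on a power of the maximal ideal -/

/-- The functionals on `S` that vanish on `𝔪 ^ e`. -/
noncomputable def vanishing (k : Type*) [Field k] (n e : ℕ) : Submodule k (Module.Dual k (PS k n)) :=
  ((maxIdeal k n ^ e).restrictScalars k).dualAnnihilator

theorem mem_vanishing {k : Type*} [Field k] {n e : ℕ} {f : Module.Dual k (PS k n)} :
    f ∈ vanishing k n e ↔ ∀ σ ∈ maxIdeal k n ^ e, f σ = 0 := by
  simp [vanishing, Submodule.mem_dualAnnihilator]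

theorem vanishing_mono {k : Type*} [Field k] {n : ℕ} {d e : ℕ} (h : d ≤ e) :
    vanishing k n d ≤ vanishing k n e := fun _ hf =>
  mem_vanishing.2 fun σ hσ => mem_vanishing.1 hf σ (Ideal.pow_le_pow_right h hσ)

theorem mem_dualCoannihilator_vanishing {k : Type*} [Field k] {n e : ℕ} {σ : PS k n} :
    σ ∈ (vanishing k n e).dualCoannihilator ↔ σ ∈ maxIdeal k n ^ e := by
  rw [vanishing, Subspace.dualAnnihilator_dualCoannihilator_eq, Submodule.restrictScalars_mem]

theorem dpMonomial_mem_vanishing {k : Type*} [Field k] {n e : ℕ} {a : Fin n →₀ ℕ}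
    (h : a.degree < e) : dpMonomial k a ∈ vanishing k n e :=
  mem_vanishing.2 fun _ hσ => mem_maxIdeal_pow_iff.1 hσ a h

/-- Modulo 𝔪^(d+1) a series is a finite combination of monomials. Note the shift: degree at most `d`
means vanishing on 𝔪^(d+1). -/
theorem dpLE_eq_vanishing (k : Type*) [Field k] (n d : ℕ) :
    dpLE k n d = vanishing k n (d + 1) := by
  apply le_antisymm
  · rw [dpLE, Submodule.span_le]
    rintro _ ⟨a, ha, rfl⟩
    exact dpMonomial_mem_vanishing (Nat.lt_succ_of_le ha)
  · intro f hf
    have key : f = ∑ a ∈ (Finsupp.finite_of_degree_le (σ := Fin n) d).toFinset,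
        f (monomial a 1) • dpMonomial k a := by
      ext σ
      have h1 := mem_vanishing.1 hf _ (sub_truncTotal_mem σ (d + 1))
      rw [map_sub, sub_eq_zero] at h1
      rw [h1, LinearMap.sum_apply]
      have h2 : ((truncTotal (d + 1) σ : MvPolynomial (Fin n) k) : PS k n) =
          ∑ a ∈ (Finsupp.finite_of_degree_le (σ := Fin n) d).toFinset,
            coeff a σ • monomial a 1 := by
        classical
        ext b
        rw [MvPolynomial.coeff_coe, coeff_truncTotal_eq_ite, map_sum]
        simp [coeff_monomial]
      rw [h2, map_sum]
      refine Finset.sum_congr rfl fun a _ => ?_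
      simp [dpMonomial, mul_comm]
    rw [key]
    refine Submodule.sum_mem _ fun a ha => Submodule.smul_mem _ _ (Submodule.subset_span ⟨a, ?_, rfl⟩)
    simpa using ha

instance finiteDimensional_vanishing (k : Type*) [Field k] (n e : ℕ) :
    FiniteDimensional k (vanishing k n e) := by
  have h : FiniteDimensional k (dpLE k n e) := by
    refine FiniteDimensional.span_of_finite k ?_
    refine ((Finsupp.finite_of_degree_le (σ := Fin n) e).image (dpMonomial k)).subset ?_
    rintro _ ⟨a, ha, rfl⟩
    exact ⟨a, ha, rfl⟩
  rw [dpLE_eq_vanishing] at h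
  exact Submodule.finiteDimensional_of_le (vanishing_mono (Nat.le_succ e))

/-- A space of functionals that separates the classes of `S / 𝔪 ^ e` contains all the functionals
vanishing on `𝔪 ^ e`. -/
theorem vanishing_le_of_forall {k : Type*} [Field k] {n e : ℕ}
    {W : Submodule k (Module.Dual k (PS k n))} [FiniteDimensional k W]
    (h : ∀ σ, (∀ g ∈ W, g σ = 0) → σ ∈ maxIdeal k n ^ e) : vanishing k n e ≤ W := by
  rw [← Subspace.dualCoannihilator_dualAnnihilator_eq (W := W)]
  intro f hf
  rw [Submodule.mem_dualAnnihilator]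
  intro σ hσ
  exact mem_vanishing.1 hf σ (h σ fun g hg => (Submodule.mem_dualCoannihilator σ).1 hσ g hg)

/-! ### Bivariate exponents and dimensions -/

/-- The exponent of the monomial `α₁ ^ a * α₂ ^ b`. -/
noncomputable def bideg (a b : ℕ) : Fin 2 →₀ ℕ := Finsupp.single 0 a + Finsupp.single 1 b

theorem degree_bideg (a b : ℕ) : (bideg a b).degree = a + b := by
  simp [bideg]

theorem bideg_add_bideg (a b c d : ℕ) : bideg a b + bideg c d = bideg (a + c) (b + d) := by
  ext i
  fin_cases i <;> simp [bideg]

theorem bideg_apply_zero (a b : ℕ) : bideg a b 0 = a := by simp [bideg]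

theorem bideg_apply_one (a b : ℕ) : bideg a b 1 = b := by simp [bideg]

theorem bideg_eta (x : Fin 2 →₀ ℕ) : bideg (x 0) (x 1) = x := by
  ext i
  fin_cases i <;> simp [bideg]

theorem degree_eq_add (x : Fin 2 →₀ ℕ) : x.degree = x 0 + x 1 := by
  rw [← degree_bideg, bideg_eta]

theorem finrank_vanishing_two (k : Type*) [Field k] (e : ℕ) :
    Module.finrank k (vanishing k 2 e) = e * (e + 1) / 2 := by
  classical
  have hli : LinearIndependent k (fun a : Fin 2 →₀ ℕ => dpMonomial k a) := by
    rw [linearIndependent_iff']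
    intro s g hg a ha
    have := LinearMap.congr_fun hg (monomial a 1)
    simpa [dpMonomial, coeff_monomial, ha] using this
  have hs : vanishing k 2 e = Submodule.span k (Set.range fun p : (Finset.range e).sigma
      (fun i => Finset.HasAntidiagonal.antidiagonal i) => dpMonomial k (bideg p.1.2.1 p.1.2.2)) := by
    rcases e with _ | d
    · refine le_antisymm (fun f hf => ?_) (Submodule.span_le.2 ?_)
      · have : f = 0 := LinearMap.ext fun σ => mem_vanishing.1 hf σ (by simp)
        rw [this]
        exact Submodule.zero_mem _
      · rintro _ ⟨⟨p, hp⟩, rfl⟩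
        simp at hp
    · rw [← dpLE_eq_vanishing, dpLE]
      congr 1
      ext g
      constructor
      · rintro ⟨a, ha, rfl⟩
        refine ⟨⟨⟨a.degree, (a 0, a 1)⟩, ?_⟩, ?_⟩
        · simp [degree_eq_add] at ha ⊢
          omega
        · simp [bideg_eta]
      · rintro ⟨⟨⟨i, p⟩, hp⟩, rfl⟩
        refine ⟨_, ?_, rfl⟩
        simp at hp
        simp [degree_bideg]
        omega
  rw [hs, finrank_span_eq_card]
  · rw [Fintype.card_coe, Finset.card_sigma]
    simp only [Finset.Nat.card_antidiagonal]
    rw [Finset.sum_add_distrib, Finset.sum_range_id]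
    simp
    rcases e with _ | d
    · rfl
    · rw [Nat.add_sub_cancel]
      have : (d + 1) * (d + 1 + 1) = (d + 1) * d + (d + 1) * 2 := by ring
      rw [this, Nat.add_mul_div_right _ _ two_pos]
  · refine hli.comp (fun p : (Finset.range e).sigma
      (fun i => Finset.HasAntidiagonal.antidiagonal i) => bideg p.1.2.1 p.1.2.2) ?_
    rintro ⟨⟨i, a, b⟩, hp⟩ ⟨⟨j, c, d⟩, hq⟩ h
    have h0 := DFunLike.congr_fun h 0
    have h1 := DFunLike.congr_fun h 1
    simp [bideg_apply_zero, bideg_apply_one] at h0 h1 hp hq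
    obtain ⟨_, rfl⟩ := hp
    obtain ⟨_, rfl⟩ := hq
    subst h0 h1
    rfl

/-! ### Unipotent endomorphisms and the group G⁺ -/

/-- A linear endomorphism of `S` raises orders if it is the identity on each `𝔪 ^ j / 𝔪 ^ (j+1)`. -/
def IsUnipotent {k : Type*} [Field k] {n : ℕ} (L : PS k n →ₗ[k] PS k n) : Prop :=
  ∀ j, ∀ σ ∈ maxIdeal k n ^ j, L σ - σ ∈ maxIdeal k n ^ (j + 1)

theorem IsUnipotent.map_mem {k : Type*} [Field k] {n : ℕ} {L : PS k n →ₗ[k] PS k n}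
    (hL : IsUnipotent L) {j : ℕ} {σ : PS k n} (hσ : σ ∈ maxIdeal k n ^ j) :
    L σ ∈ maxIdeal k n ^ j := by
  have := Ideal.add_mem _ (Ideal.pow_le_pow_right (Nat.le_succ j) (hL j σ hσ)) hσ
  simpa using this

theorem IsUnipotent.mem_of_map_mem {k : Type*} [Field k] {n : ℕ} {L : PS k n →ₗ[k] PS k n}
    (hL : IsUnipotent L) {j : ℕ} {σ : PS k n} (hσ : L σ ∈ maxIdeal k n ^ j) :
    σ ∈ maxIdeal k n ^ j := by
  suffices ∀ i ≤ j, σ ∈ maxIdeal k n ^ i from this j le_rfl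
  intro i
  induction i with
  | zero => simp
  | succ i ih =>
    intro hi
    have := Ideal.sub_mem _ (Ideal.pow_le_pow_right hi hσ) (hL i σ (ih (by omega)))
    simpa using this

theorem IsUnipotent.injective {k : Type*} [Field k] {n : ℕ} {L : PS k n →ₗ[k] PS k n}
    (hL : IsUnipotent L) : Function.Injective L := by
  rw [injective_iff_map_eq_zero]
  intro σ hσ
  refine eq_of_sub_mem_maxIdeal_pow fun e => ?_
  rw [sub_zero]
  exact hL.mem_of_map_mem (by rw [hσ]; exact Ideal.zero_mem _)

/-- Successive approximation: adding the error `τ - L x` to `x` moves the new error one power of 𝔪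
deeper. -/
theorem IsUnipotent.surjective {k : Type*} [Field k] {n : ℕ} {L : PS k n →ₗ[k] PS k n}
    (hL : IsUnipotent L) : Function.Surjective L := by
  intro τ
  let x : ℕ → PS k n := fun e => Nat.rec 0 (fun _ y => y + (τ - L y)) e
  have hx : ∀ e, τ - L (x e) ∈ maxIdeal k n ^ e := by
    intro e
    induction e with
    | zero => simp
    | succ e ih =>
      have h1 := Ideal.neg_mem_iff _ |>.2 (hL e _ ih)
      have h2 : τ - L (x (e + 1)) = -(L (τ - L (x e)) - (τ - L (x e))) := by
        show τ - L (x e + (τ - L (x e))) = _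
        rw [map_add]
        ring
      rwa [h2]
  have hd : ∀ d e, d ≤ e → x e - x d ∈ maxIdeal k n ^ d := by
    intro d e hde
    induction e, hde using Nat.le_induction with
    | base => simp
    | succ e hde ih =>
      have h1 : x (e + 1) - x d = (τ - L (x e)) + (x e - x d) := by
        show x e + (τ - L (x e)) - x d = _
        ring
      rw [h1]
      exact Ideal.add_mem _ (Ideal.pow_le_pow_right hde (hx e)) ih
  -- The 𝔪-adic limit: by `hd`, the coefficient at `a` is stationary from stage `a.degree + 1` on.
  let y : PS k n := fun a => coeff a (x (a.degree + 1))
  have hy : ∀ e, y - x e ∈ maxIdeal k n ^ e := by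
    intro e
    rw [mem_maxIdeal_pow_iff]
    intro a ha
    have h1 := mem_maxIdeal_pow_iff.1 (hd (a.degree + 1) e ha) a (Nat.lt_succ_self _)
    rw [map_sub, sub_eq_zero] at h1
    rw [map_sub, h1, sub_eq_zero]
    rfl
  refine ⟨y, eq_of_sub_mem_maxIdeal_pow fun e => ?_⟩
  have h1 : L y - τ = L (y - x e) - (τ - L (x e)) := by
    rw [map_sub]
    ring
  rw [h1]
  exact Ideal.sub_mem _ (hL.map_mem (hy e)) (hx e)

theorem isUnipotent_mulLeft {k : Type*} [Field k] {n : ℕ} {s : PS k n}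
    (hs : s - 1 ∈ maxIdeal k n) : IsUnipotent (LinearMap.mulLeft k s) := by
  intro j σ hσ
  have h1 : LinearMap.mulLeft k s σ - σ = σ * (s - 1) := by
    rw [LinearMap.mulLeft_apply]
    ring
  rw [h1, pow_succ]
  exact Ideal.mul_mem_mul hσ hs

/-- No continuity of `φ` is needed: after the constant term is removed, writing the rest as ∑ Xᵢ qᵢ
gains one power of 𝔪 per round. -/
theorem algHom_sub_self_mem {k : Type*} [Field k] {n r : ℕ} {φ : PS k n →ₐ[k] PS k n}
    (hφ : ∀ i, φ (X i) - X i ∈ maxIdeal k n ^ (r + 1)) (τ : PS k n) :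
    φ τ - τ ∈ maxIdeal k n ^ (r + 1) := by
  suffices ∀ N ≤ r + 1, ∀ τ, φ τ - τ ∈ maxIdeal k n ^ N from this _ le_rfl τ
  intro N
  induction N with
  | zero => simp
  | succ N ih =>
    intro hN τ
    set c : PS k n := algebraMap k _ (constantCoeff τ) with hc
    have hτ : constantCoeff (τ - c) = 0 := by
      rw [hc, MvPowerSeries.algebraMap_apply]
      simp
    have h1 : φ τ - τ = ∑ i, ((φ (X i) - X i) * φ (divVar i (τ - c)) +
        X i * (φ (divVar i (τ - c)) - divVar i (τ - c))) := by
      have h2 : φ τ - τ = φ (τ - c) - (τ - c) := by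
        rw [map_sub, hc, AlgHom.commutes]
        ring
      rw [h2]
      conv_lhs => rw [← sum_X_mul_divVar hτ]
      rw [map_sum, ← Finset.sum_sub_distrib]
      refine Finset.sum_congr rfl fun i _ => ?_
      rw [map_mul]
      ring
    rw [h1]
    refine Ideal.sum_mem _ fun i _ => Ideal.add_mem _ ?_ ?_
    · exact Ideal.mul_mem_right _ _ (Ideal.pow_le_pow_right hN (hφ i))
    · rw [pow_succ']
      exact Ideal.mul_mem_mul (X_mem_maxIdeal k i) (ih (by omega) _)

theorem algHom_sub_self_mem_add {k : Type*} [Field k] {n r : ℕ} {φ : PS k n →ₐ[k] PS k n}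
    (hφ : ∀ i, φ (X i) - X i ∈ maxIdeal k n ^ (r + 1)) {j : ℕ} {τ : PS k n}
    (hτ : τ ∈ maxIdeal k n ^ j) : φ τ - τ ∈ maxIdeal k n ^ (j + r) := by
  induction j generalizing τ with
  | zero => exact Ideal.pow_le_pow_right (by omega) (algHom_sub_self_mem hφ τ)
  | succ j ih =>
    rw [pow_succ] at hτ
    refine Submodule.mul_induction_on hτ (fun a ha b hb => ?_) (fun a b ha hb => ?_)
    · have h1 : φ (a * b) - a * b = (φ a - a) * φ b + a * (φ b - b) := by
        rw [map_mul]
        ring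
      rw [h1]
      have hb' := algHom_sub_self_mem hφ b
      refine Ideal.add_mem _ ?_ ?_
      · have hb2 : φ b ∈ maxIdeal k n := by
          have := Ideal.add_mem _ (Ideal.pow_le_self (by omega) hb') hb
          simpa using this
        have := Ideal.mul_mem_mul (ih ha) hb2
        rw [← pow_succ] at this
        exact Ideal.pow_le_pow_right (by omega) this
      · have := Ideal.mul_mem_mul ha hb'
        rw [← pow_add] at this
        exact Ideal.pow_le_pow_right (by omega) this
    · have h1 : φ (a + b) - (a + b) = (φ a - a) + (φ b - b) := by
        rw [map_add]
        ring
      rw [h1]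
      exact Ideal.add_mem _ ha hb

theorem isUnipotent_algHom {k : Type*} [Field k] {n : ℕ} {φ : PS k n →ₐ[k] PS k n}
    (hφ : ∀ i, φ (X i) - X i ∈ maxIdeal k n ^ 2) : IsUnipotent φ.toLinearMap :=
  fun _ _ hσ => algHom_sub_self_mem_add (r := 1) hφ hσ

theorem isUnipotent_of_mem_gPlus {k : Type*} [Field k] {n : ℕ} {L : PS k n ≃ₗ[k] PS k n}
    (hL : L ∈ gPlus k n) : IsUnipotent (L : PS k n →ₗ[k] PS k n) := by
  induction hL using Subgroup.closure_induction with
  | mem L h =>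
    rcases h with ⟨φ, hφ, rfl⟩ | ⟨s, hs, h⟩
    · exact isUnipotent_algHom (φ := φ.toAlgHom) hφ
    · have : (L : PS k n →ₗ[k] PS k n) = LinearMap.mulLeft k s := LinearMap.ext h
      rw [this]
      exact isUnipotent_mulLeft hs
  | one =>
    intro j σ _
    simp
  | mul L L' _ _ h h' =>
    intro j σ hσ
    have := Ideal.add_mem _ (h j _ (h'.map_mem hσ)) (h' j σ hσ)
    simpa using this
  | inv L _ h =>
    intro j σ hσ
    have hs : L (L⁻¹ σ) = σ := L.apply_symm_apply σ
    have h1 : L⁻¹ σ ∈ maxIdeal k n ^ j := h.mem_of_map_mem (by simpa [hs] using hσ)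
    have h2 := Ideal.neg_mem_iff _ |>.2 (h j _ h1)
    simpa [hs] using h2

theorem mem_apolarIdeal {k : Type*} [Field k] {n : ℕ} {f : Module.Dual k (PS k n)} {σ : PS k n} :
    σ ∈ apolarIdeal f ↔ ∀ τ, f (τ * σ) = 0 :=
  LinearMap.ext_iff

/-- Unit factors leave apolar ideals unchanged, so only the automorphism part of `L` matters. One
`φ` has to serve all `g`, since products and inverses apply it to other functionals. -/
theorem exists_apolarIdeal_eq_comap {k : Type*} [Field k] {n : ℕ} {L : PS k n ≃ₗ[k] PS k n}
    (hL : L ∈ gPlus k n) : ∃ φ : PS k n ≃ₐ[k] PS k n, ∀ g : Module.Dual k (PS k n), ∀ σ,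
      σ ∈ apolarIdeal (g ∘ₗ (L : PS k n →ₗ[k] PS k n)) ↔ φ σ ∈ apolarIdeal g := by
  induction hL using Subgroup.closure_induction with
  | mem L h =>
    rcases h with ⟨φ, hφ, rfl⟩ | ⟨s, hs, h⟩
    · refine ⟨φ, fun g σ => ?_⟩
      rw [mem_apolarIdeal, mem_apolarIdeal]
      refine ⟨fun H τ => ?_, fun H τ => ?_⟩
      · simpa using H (φ.symm τ)
      · simpa using H (φ τ)
    · refine ⟨AlgEquiv.refl, fun g σ => ?_⟩
      have hu : IsUnit s := by
        rw [MvPowerSeries.isUnit_iff_constantCoeff]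
        have h1 := mem_maxIdeal_iff.1 hs
        rw [map_sub, map_one, sub_eq_zero] at h1
        simp [h1]
      obtain ⟨u, rfl⟩ := hu
      rw [mem_apolarIdeal, mem_apolarIdeal]
      simp only [LinearMap.comp_apply, LinearEquiv.coe_coe, h, AlgEquiv.coe_refl, id]
      refine ⟨fun H τ => ?_, fun H τ => ?_⟩
      · simpa [← mul_assoc] using H (u⁻¹.1 * τ)
      · simpa [mul_assoc] using H (u * τ)
  | one => exact ⟨AlgEquiv.refl, fun g σ => Iff.rfl⟩
  | mul L L' _ _ h h' =>
    obtain ⟨φ, hφ⟩ := h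
    obtain ⟨φ', hφ'⟩ := h'
    refine ⟨φ'.trans φ, fun g σ => ?_⟩
    rw [AlgEquiv.trans_apply, ← hφ, ← hφ']
    rfl
  | inv L _ h =>
    obtain ⟨φ, hφ⟩ := h
    refine ⟨φ.symm, fun g σ => ?_⟩
    have h1 := hφ (g ∘ₗ ((L⁻¹ : PS k n ≃ₗ[k] PS k n) : PS k n →ₗ[k] PS k n)) (φ.symm σ)
    rw [φ.apply_symm_apply] at h1
    rw [← h1]
    have h2 : (g ∘ₗ ((L⁻¹ : PS k n ≃ₗ[k] PS k n) : PS k n →ₗ[k] PS k n)) ∘ₗ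
        (L : PS k n →ₗ[k] PS k n) = g :=
      LinearMap.ext fun τ => congrArg g (L.symm_apply_apply τ)
    rw [h2]

theorem exists_mem_gPlus_mul {k : Type*} [Field k] {n : ℕ} {s : PS k n} (hs : s ∈ maxIdeal k n) :
    ∃ L ∈ gPlus k n, ∀ σ, L σ = σ + s * σ := by
  have h1 : (1 + s) - 1 ∈ maxIdeal k n := by simpa using hs
  have hu := isUnipotent_mulLeft h1
  refine ⟨LinearEquiv.ofBijective _ ⟨hu.injective, hu.surjective⟩,
    Subgroup.subset_closure (Or.inr ⟨1 + s, h1, fun τ => rfl⟩), fun σ => ?_⟩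
  show (1 + s) * σ = _
  ring

theorem exists_algEquiv_X_add {k : Type*} [Field k] {n : ℕ} {d : Fin n → PS k n}
    (hd : ∀ i, d i ∈ maxIdeal k n ^ 2) :
    ∃ φ : PS k n ≃ₐ[k] PS k n, (∀ i, φ (X i) = X i + d i) ∧ φ.toLinearEquiv ∈ gPlus k n := by
  have hs : HasSubst (fun i => (X i + d i : PS k n)) := by
    refine hasSubst_of_constantCoeff_zero fun i => ?_
    rw [map_add, constantCoeff_X, mem_maxIdeal_iff.1 (Ideal.pow_le_self two_ne_zero (hd i)),
      add_zero]
  have hX : ∀ i, substAlgHom (R := k) hs (X i) = X i + d i := fun i => substAlgHom_X hs i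
  have hX' : ∀ i, substAlgHom (R := k) hs (X i) - X i ∈ maxIdeal k n ^ 2 := fun i => by
    simpa [hX] using hd i
  have hu := isUnipotent_algHom hX'
  refine ⟨AlgEquiv.ofBijective _ ⟨hu.injective, hu.surjective⟩, hX,
    Subgroup.subset_closure (Or.inl ⟨_, hX', rfl⟩)⟩

/-! ### First-order expansion of automorphisms in two variables -/

/-- The monomial `α₁ ^ a * α₂ ^ b`. -/
noncomputable def mon (k : Type*) [Field k] (a b : ℕ) : PS k 2 := monomial (bideg a b) 1

theorem mon_mul_mon (k : Type*) [Field k] (a b c d : ℕ) :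
    mon k a b * mon k c d = mon k (a + c) (b + d) := by
  rw [mon, mon, mon, monomial_mul_monomial, bideg_add_bideg, one_mul]

theorem mon_eq_pow (k : Type*) [Field k] (a b : ℕ) : mon k a b = X 0 ^ a * X 1 ^ b := by
  rw [X_pow_eq, X_pow_eq, monomial_mul_monomial, one_mul]
  rfl

theorem mon_mem (k : Type*) [Field k] {a b e : ℕ} (h : e ≤ a + b) :
    mon k a b ∈ maxIdeal k 2 ^ e :=
  monomial_mem_maxIdeal_pow _ _ (by rwa [degree_bideg])

theorem coeff_bideg_mon (k : Type*) [Field k] (a b c d : ℕ) :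
    coeff (bideg a b) (mon k c d) = if a = c ∧ b = d then 1 else 0 := by
  classical
  rw [mon, coeff_monomial]
  congr 1
  rw [eq_iff_iff]
  constructor
  · intro h
    have h0 := DFunLike.congr_fun h 0
    have h1 := DFunLike.congr_fun h 1
    rw [bideg_apply_zero, bideg_apply_zero] at h0
    rw [bideg_apply_one, bideg_apply_one] at h1
    exact ⟨h0, h1⟩
  · rintro ⟨rfl, rfl⟩
    rfl

theorem sub_sum_mon_mem {k : Type*} [Field k] {j : ℕ} {σ : PS k 2} (hσ : σ ∈ maxIdeal k 2 ^ j) :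
    σ - ∑ l ∈ Finset.range (j + 1), coeff (bideg (j - l) l) σ • mon k (j - l) l ∈
      maxIdeal k 2 ^ (j + 1) := by
  rw [mem_maxIdeal_pow_iff] at hσ ⊢
  intro a ha
  rcases Nat.lt_succ_iff_lt_or_eq.1 ha with h | h
  · rw [map_sub, hσ a h, map_sum, Finset.sum_eq_zero, sub_zero]
    intro l hl
    rw [Finset.mem_range] at hl
    rw [← bideg_eta a, coeff_smul, coeff_bideg_mon, if_neg, mul_zero]
    rintro ⟨h0, h1⟩
    rw [degree_eq_add] at h
    omega
  · rw [← bideg_eta a]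
    rw [degree_eq_add] at h
    generalize a 0 = x at *
    generalize a 1 = y at *
    rw [map_sub, map_sum, Finset.sum_eq_single y]
    · have : j - y = x := by omega
      rw [coeff_smul, coeff_bideg_mon, this]
      simp
    · intro l _ hl
      rw [coeff_smul, coeff_bideg_mon, if_neg, mul_zero]
      exact fun h => hl h.2.symm
    · intro h'
      simp at h'
      omega

/-- First-order Taylor expansion: the remainder is divisible by d², so it lies in 𝔪^(a+2r), and `1 ≤
r`. For `a = 0` the truncated exponent `a - 1` carries the coefficient zero. -/
theorem add_pow_sub_mem {k : Type*} [Field k] {n r : ℕ} (hr : 1 ≤ r) {x d : PS k n}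
    (hx : x ∈ maxIdeal k n) (hd : d ∈ maxIdeal k n ^ (r + 1)) (a : ℕ) :
    (x + d) ^ a - x ^ a - (a : k) • (x ^ (a - 1) * d) ∈ maxIdeal k n ^ (a + r + 1) := by
  induction a with
  | zero => simp
  | succ a ih =>
    have hxd : x + d ∈ maxIdeal k n := Ideal.add_mem _ hx (Ideal.pow_le_self (by omega) hd)
    have h1 : (x + d) ^ (a + 1) - x ^ (a + 1) - ((a + 1 : ℕ) : k) • (x ^ (a + 1 - 1) * d) =
        ((x + d) ^ a - x ^ a - (a : k) • (x ^ (a - 1) * d)) * (x + d) +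
          (a : k) • (x ^ (a - 1) * (d * d)) := by
      rw [Nat.add_sub_cancel]
      simp only [Algebra.smul_def, map_natCast]
      rcases a with _ | a
      · simp
      · rw [Nat.add_sub_cancel]
        push_cast
        ring
    rw [h1]
    refine Ideal.add_mem _ ?_ ?_
    · have := Ideal.mul_mem_mul ih hxd
      rw [← pow_succ] at this
      exact Ideal.pow_le_pow_right (by omega) this
    · rw [Algebra.smul_def]
      refine Ideal.mul_mem_left _ _ ?_
      have := Ideal.mul_mem_mul (Ideal.pow_mem_pow hx (a - 1)) (Ideal.mul_mem_mul hd hd)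
      rw [← pow_add, ← pow_add] at this
      exact Ideal.pow_le_pow_right (by omega) this

theorem algHom_mon_sub_mem {k : Type*} [Field k] {r : ℕ} (hr : 1 ≤ r) {d : Fin 2 → PS k 2}
    (hd : ∀ i, d i ∈ maxIdeal k 2 ^ (r + 1)) {φ : PS k 2 →ₐ[k] PS k 2}
    (hφ : ∀ i, φ (X i) = X i + d i) (a b : ℕ) :
    φ (mon k a b) - mon k a b -
      ((a : k) • (mon k (a - 1) b * d 0) + (b : k) • (mon k a (b - 1) * d 1)) ∈
        maxIdeal k 2 ^ (a + b + r + 1) := by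
  have hX := X_mem_maxIdeal k (n := 2)
  have hderiv : ∀ i (c : ℕ), (c : k) • (X i ^ (c - 1) * d i) ∈ maxIdeal k 2 ^ (c + r) := by
    intro i c
    rcases c with _ | c
    · simp
    · rw [Algebra.smul_def]
      refine Ideal.mul_mem_left _ _ ?_
      have := Ideal.mul_mem_mul (Ideal.pow_mem_pow (hX i) c) (hd i)
      rw [← pow_add] at this
      exact Ideal.pow_le_pow_right (by omega) this
  have ha := add_pow_sub_mem hr (hX 0) (hd 0) a
  have hb := add_pow_sub_mem hr (hX 1) (hd 1) b
  have hbφ : (X 1 + d 1) ^ b ∈ maxIdeal k 2 ^ b := Ideal.pow_mem_pow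
    (Ideal.add_mem _ (hX 1) (Ideal.pow_le_self (by omega) (hd 1))) b
  have hda := hderiv 0 a
  have hdb := hderiv 1 b
  have e1 : (a : k) • (mon k (a - 1) b * d 0) = ((a : k) • (X 0 ^ (a - 1) * d 0)) * X 1 ^ b := by
    rw [mon_eq_pow, smul_mul_assoc]
    congr 1
    ring
  have e2 : (b : k) • (mon k a (b - 1) * d 1) = X 0 ^ a * ((b : k) • (X 1 ^ (b - 1) * d 1)) := by
    rw [mon_eq_pow, mul_smul_comm]
    congr 1
    ring
  rw [e1, e2, mon_eq_pow, map_mul, map_pow, map_pow, hφ, hφ]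
  generalize (a : k) • (X 0 ^ (a - 1) * d 0) = da at *
  generalize (b : k) • (X 1 ^ (b - 1) * d 1) = db at *
  have key : (X 0 + d 0) ^ a * (X 1 + d 1) ^ b - X 0 ^ a * X 1 ^ b -
      (da * X 1 ^ b + X 0 ^ a * db) =
      ((X 0 + d 0) ^ a - X 0 ^ a - da) * (X 1 + d 1) ^ b +
      (X 0 ^ a * ((X 1 + d 1) ^ b - X 1 ^ b - db) +
      (da * ((X 1 + d 1) ^ b - X 1 ^ b - db) + da * db)) := by
    ring
  rw [key]
  refine Ideal.add_mem _ ?_ (Ideal.add_mem _ ?_ (Ideal.add_mem _ ?_ ?_))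
  · have := Ideal.mul_mem_mul ha hbφ
    rw [← pow_add] at this
    exact Ideal.pow_le_pow_right (by omega) this
  · have := Ideal.mul_mem_mul (Ideal.pow_mem_pow (hX 0) a) hb
    rw [← pow_add] at this
    exact Ideal.pow_le_pow_right (by omega) this
  · have := Ideal.mul_mem_mul hda hb
    rw [← pow_add] at this
    exact Ideal.pow_le_pow_right (by omega) this
  · have := Ideal.mul_mem_mul hda hdb
    rw [← pow_add] at this
    exact Ideal.pow_le_pow_right (by omega) this

/-- The sum is the derivation ∑ dᵢ ∂/∂αᵢ applied to the degree `j` part of `σ`. -/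
theorem algHom_sub_sum_mem {k : Type*} [Field k] {r : ℕ} (hr : 1 ≤ r) {d : Fin 2 → PS k 2}
    (hd : ∀ i, d i ∈ maxIdeal k 2 ^ (r + 1)) {φ : PS k 2 →ₐ[k] PS k 2}
    (hφ : ∀ i, φ (X i) = X i + d i) {j : ℕ} {σ : PS k 2} (hσ : σ ∈ maxIdeal k 2 ^ j) :
    φ σ - σ - ∑ l ∈ Finset.range (j + 1), coeff (bideg (j - l) l) σ •
      (((j - l : ℕ) : k) • (mon k (j - l - 1) l * d 0) + (l : k) • (mon k (j - l) (l - 1) * d 1)) ∈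
        maxIdeal k 2 ^ (j + r + 1) := by
  have h1 := algHom_sub_self_mem_add (φ := φ) (r := r) (fun i => by simpa [hφ] using hd i)
    (sub_sum_mon_mem hσ)
  rw [map_sub, map_sum] at h1
  have h2 : ∑ l ∈ Finset.range (j + 1), coeff (bideg (j - l) l) σ •
      (φ (mon k (j - l) l) - mon k (j - l) l - (((j - l : ℕ) : k) • (mon k (j - l - 1) l * d 0) +
        (l : k) • (mon k (j - l) (l - 1) * d 1))) ∈ maxIdeal k 2 ^ (j + r + 1) := by
    refine Ideal.sum_mem _ fun l hl => ?_
    rw [Algebra.smul_def]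
    refine Ideal.mul_mem_left _ _ ?_
    have := algHom_mon_sub_mem hr hd hφ (j - l) l
    rw [Finset.mem_range] at hl
    rwa [show j - l + l = j by omega] at this
  have h3 := Ideal.add_mem _ (Ideal.pow_le_pow_right (show j + r + 1 ≤ j + 1 + r by omega) h1) h2
  convert h3 using 1
  simp only [smul_sub, Finset.sum_sub_distrib, map_smul]
  ring

/-! ### Hankel matrices, the apolar cubic and its Hessian -/

/-- The `3 × 3` determinant with columns `i`, `j`, `l` of the Hankel matrix `w (r + c)`. -/
def hankelDet {R : Type*} [CommRing R] (w : ℕ → R) (i j l : ℕ) : R :=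
  w i * (w (j + 1) * w (l + 2) - w (l + 1) * w (j + 2)) -
    w j * (w (i + 1) * w (l + 2) - w (l + 1) * w (i + 2)) +
    w l * (w (i + 1) * w (j + 2) - w (j + 1) * w (i + 2))

/-- The signed maximal minors of the `3 × 4` Hankel matrix of `w`. They are the coefficients of a
cubic form apolar to the quintic with coefficients `w`. -/
def apolarCubic {R : Type*} [CommRing R] (w : ℕ → R) : Fin 4 → R :=
  ![hankelDet w 1 2 3, -hankelDet w 0 2 3, hankelDet w 0 1 3, -hankelDet w 0 1 2]

/-- The coefficients, up to scalars, of the Hessian of the binary cubic with coefficients `c`. -/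
def hessian {R : Type*} [CommRing R] (c : Fin 4 → R) : Fin 3 → R :=
  ![3 * (c 0 * c 2) - c 1 ^ 2, 9 * (c 0 * c 3) - c 1 * c 2, 3 * (c 1 * c 3) - c 2 ^ 2]

/-- `c` lies in the kernel of the `3 × 4` Hankel matrix of `w`. -/
def HankelKer {R : Type*} [CommRing R] (w : ℕ → R) (c : Fin 4 → R) : Prop :=
  ∀ v < 3, c 0 * w v + c 1 * w (v + 1) + c 2 * w (v + 2) + c 3 * w (v + 3) = 0

theorem hankelKer_apolarCubic {R : Type*} [CommRing R] (w : ℕ → R) :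
    HankelKer w (apolarCubic w) := by
  intro v hv
  interval_cases v <;> simp [apolarCubic, hankelDet] <;> ring

/-- Cramer's rule without division: the multipliers are the 2 × 2 minors of the two columns other
than `i` and `j`. -/
theorem HankelKer.mul_comm {R : Type*} [CommRing R] {w : ℕ → R} {c : Fin 4 → R}
    (hc : HankelKer w c) (i j : Fin 4) : c i * apolarCubic w j = c j * apolarCubic w i := by
  have h0 := hc 0 (by norm_num)
  have h1 := hc 1 (by norm_num)
  have h2 := hc 2 (by norm_num)
  simp only [Nat.reduceAdd] at h0 h1 h2
  have e01 : c 0 * apolarCubic w 1 = c 1 * apolarCubic w 0 := by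
    simp only [apolarCubic, hankelDet, Matrix.cons_val, Nat.reduceAdd]
    linear_combination (-1 : R) * ((w 3 * w 5 - w 4 * w 4) * h0 - (w 2 * w 5 - w 3 * w 4) * h1 +
      (w 2 * w 4 - w 3 * w 3) * h2)
  have e02 : c 0 * apolarCubic w 2 = c 2 * apolarCubic w 0 := by
    simp only [apolarCubic, hankelDet, Matrix.cons_val, Nat.reduceAdd]
    linear_combination (w 2 * w 5 - w 4 * w 3) * h0 - (w 1 * w 5 - w 3 * w 3) * h1 +
      (w 1 * w 4 - w 3 * w 2) * h2
  have e03 : c 0 * apolarCubic w 3 = c 3 * apolarCubic w 0 := by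
    simp only [apolarCubic, hankelDet, Matrix.cons_val, Nat.reduceAdd]
    linear_combination (-1 : R) * ((w 2 * w 4 - w 3 * w 3) * h0 - (w 1 * w 4 - w 2 * w 3) * h1 +
      (w 1 * w 3 - w 2 * w 2) * h2)
  have e12 : c 1 * apolarCubic w 2 = c 2 * apolarCubic w 1 := by
    simp only [apolarCubic, hankelDet, Matrix.cons_val, Nat.reduceAdd]
    linear_combination (-1 : R) * ((w 1 * w 5 - w 4 * w 2) * h0 - (w 0 * w 5 - w 3 * w 2) * h1 +
      (w 0 * w 4 - w 3 * w 1) * h2)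
  have e13 : c 1 * apolarCubic w 3 = c 3 * apolarCubic w 1 := by
    simp only [apolarCubic, hankelDet, Matrix.cons_val, Nat.reduceAdd]
    linear_combination (w 1 * w 4 - w 3 * w 2) * h0 - (w 0 * w 4 - w 2 * w 2) * h1 +
      (w 0 * w 3 - w 2 * w 1) * h2
  have e23 : c 2 * apolarCubic w 3 = c 3 * apolarCubic w 2 := by
    simp only [apolarCubic, hankelDet, Matrix.cons_val, Nat.reduceAdd]
    linear_combination (-1 : R) * ((w 1 * w 3 - w 2 * w 2) * h0 - (w 0 * w 3 - w 2 * w 1) * h1 +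
      (w 0 * w 2 - w 1 * w 1) * h2)
  fin_cases i <;> fin_cases j <;> first | rfl | assumption | (symm; assumption)

theorem HankelKer.exists_eq_smul {k : Type*} [Field k] {w : ℕ → k} {c : Fin 4 → k}
    (hc : HankelKer w c) (hw : apolarCubic w ≠ 0) : ∃ t : k, c = t • apolarCubic w := by
  obtain ⟨i, hi⟩ := Function.ne_iff.1 hw
  refine ⟨c i / apolarCubic w i, funext fun j => ?_⟩
  have := hc.mul_comm i j
  rw [Pi.smul_apply, smul_eq_mul, div_mul_eq_mul_div, eq_div_iff hi, this]

theorem apolarCubic_ne_zero_of_hessian {R : Type*} [CommRing R] {w : ℕ → R}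
    (h : hessian (apolarCubic w) ≠ 0) : apolarCubic w ≠ 0 := by
  intro h0
  apply h
  rw [h0]
  ext i
  fin_cases i <;> simp [hessian]

/-- The quintic with coefficients `w` is annihilated by no nonzero quadric. -/
def NoQuadric {R : Type*} [CommRing R] (w : ℕ → R) : Prop :=
  ∀ q : Fin 3 → R, (∀ i < 4, q 0 * w i + q 1 * w (i + 1) + q 2 * w (i + 2) = 0) → q = 0

theorem eq_zero_of_hankelDet {k : Type*} [Field k] {w : ℕ → k} {i j l : ℕ}
    (h : hankelDet w i j l ≠ 0) {q : Fin 3 → k}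
    (hi : q 0 * w i + q 1 * w (i + 1) + q 2 * w (i + 2) = 0)
    (hj : q 0 * w j + q 1 * w (j + 1) + q 2 * w (j + 2) = 0)
    (hl : q 0 * w l + q 1 * w (l + 1) + q 2 * w (l + 2) = 0) : q = 0 := by
  unfold hankelDet at h
  ext r
  refine (mul_eq_zero.1 (?_ : q r * _ = 0)).resolve_right h
  fin_cases r
  · show q 0 * _ = 0
    linear_combination (w (j + 1) * w (l + 2) - w (l + 1) * w (j + 2)) * hi -
      (w (i + 1) * w (l + 2) - w (l + 1) * w (i + 2)) * hj +
      (w (i + 1) * w (j + 2) - w (j + 1) * w (i + 2)) * hl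
  · show q 1 * _ = 0
    linear_combination -(w j * w (l + 2) - w l * w (j + 2)) * hi +
      (w i * w (l + 2) - w l * w (i + 2)) * hj - (w i * w (j + 2) - w j * w (i + 2)) * hl
  · show q 2 * _ = 0
    linear_combination (w j * w (l + 1) - w l * w (j + 1)) * hi -
      (w i * w (l + 1) - w l * w (i + 1)) * hj + (w i * w (j + 1) - w j * w (i + 1)) * hl

theorem noQuadric_of_apolarCubic_ne_zero {k : Type*} [Field k] {w : ℕ → k}
    (h : apolarCubic w ≠ 0) : NoQuadric w := by
  intro q hq
  by_contra hne
  apply h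
  have key : ∀ i j l, i < 4 → j < 4 → l < 4 → hankelDet w i j l = 0 := fun i j l hi hj hl =>
    by_contra fun hd => hne (eq_zero_of_hankelDet hd (hq i hi) (hq j hj) (hq l hl))
  ext i
  fin_cases i <;> simp [apolarCubic, key]

/-- If all maximal minors vanish, the vector product of two columns is a quadric killing the
quintic, hence zero. The columns are then pairwise proportional, so vectors orthogonal to one
nonzero column are orthogonal to all and give nonzero quadrics. -/
theorem apolarCubic_ne_zero_of_noQuadric {k : Type*} [Field k] {w : ℕ → k}
    (h : NoQuadric w) : apolarCubic w ≠ 0 := by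
  intro hC
  have d123 : hankelDet w 1 2 3 = 0 := congrFun hC 0
  have d023 : hankelDet w 0 2 3 = 0 := neg_eq_zero.1 (congrFun hC 1)
  have d013 : hankelDet w 0 1 3 = 0 := congrFun hC 2
  have d012 : hankelDet w 0 1 2 = 0 := neg_eq_zero.1 (congrFun hC 3)
  have hone : (1 : k) ≠ 0 := one_ne_zero
  -- The vector product of two columns is orthogonal to all columns.
  have cross : ∀ i < 4, ∀ j < 4, w (i + 1) * w (j + 2) = w (j + 1) * w (i + 2) ∧
      w j * w (i + 2) = w i * w (j + 2) ∧ w i * w (j + 1) = w j * w (i + 1) := by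
    intro i hi j hj
    have hq := h ![w (i + 1) * w (j + 2) - w (j + 1) * w (i + 2),
      w j * w (i + 2) - w i * w (j + 2), w i * w (j + 1) - w j * w (i + 1)] (by
        unfold hankelDet at d123 d023 d013 d012
        simp only [Nat.reduceAdd, zero_add] at d123 d023 d013 d012
        intro l hl
        simp only [Matrix.cons_val]
        interval_cases i <;> interval_cases j <;> interval_cases l <;>
          simp only [Nat.reduceAdd, zero_add] <;>
          first
          | ring1
          | linear_combination d123
          | linear_combination d023
          | linear_combination d013
          | linear_combination d012
          | linear_combination -d123
          | linear_combination -d023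
          | linear_combination -d013
          | linear_combination -d012)
    refine ⟨?_, ?_, ?_⟩
    · simpa [sub_eq_zero] using congrFun hq 0
    · simpa [sub_eq_zero] using congrFun hq 1
    · simpa [sub_eq_zero] using congrFun hq 2
  by_cases hw : ∀ i < 4, w i = 0 ∧ w (i + 1) = 0 ∧ w (i + 2) = 0
  · have := h (fun _ => 1) fun i hi => by
      obtain ⟨h0, h1, h2⟩ := hw i hi
      simp [h0, h1, h2]
    exact hone (congrFun this 0)
  · push Not at hw
    obtain ⟨i, hi, hw⟩ := hw
    have q1 := h ![w (i + 1), -w i, 0] fun j hj => by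
      simp only [Matrix.cons_val]
      linear_combination -(cross i hi j hj).2.2
    have q2 := h ![w (i + 2), 0, -w i] fun j hj => by
      simp only [Matrix.cons_val]
      linear_combination (cross i hi j hj).2.1
    have h0 : w i = 0 := neg_eq_zero.1 (congrFun q1 1)
    exact hw h0 (congrFun q1 0) (congrFun q2 0)

theorem hessian_smul {R : Type*} [CommRing R] (t : R) (c : Fin 4 → R) :
    hessian (t • c) = t ^ 2 • hessian c := by
  ext i
  fin_cases i <;> simp [hessian] <;> ring

/-- The coefficients of the cube of the linear form `a * x + b * y`. -/
def cubeCoeff {R : Type*} [CommRing R] (a b : R) : Fin 4 → R :=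
  ![a ^ 3, 3 * (a ^ 2 * b), 3 * (a * b ^ 2), b ^ 3]

theorem hessian_cubeCoeff {R : Type*} [CommRing R] (a b : R) : hessian (cubeCoeff a b) = 0 := by
  ext i
  fin_cases i <;> simp [hessian, cubeCoeff] <;> ring

/-- If `c 0 = 0`, the Hessian kills `c 1` and `c 2`. Otherwise a cube root `a` of `c 0` determines
`b` from `c 1`, and two Hessian equations determine the other coefficients. -/
theorem exists_eq_cubeCoeff {k : Type*} [Field k] [IsAlgClosed k] (h3 : (3 : k) ≠ 0)
    {c : Fin 4 → k} (hc : hessian c = 0) : ∃ a b, c = cubeCoeff a b := by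
  have e0 : 3 * (c 0 * c 2) - c 1 ^ 2 = 0 := congrFun hc 0
  have e1 : 9 * (c 0 * c 3) - c 1 * c 2 = 0 := congrFun hc 1
  have e2 : 3 * (c 1 * c 3) - c 2 ^ 2 = 0 := congrFun hc 2
  by_cases h0 : c 0 = 0
  · have h1 : c 1 = 0 := by
      rw [h0] at e0
      simpa using e0
    have h2 : c 2 = 0 := by
      rw [h1] at e2
      simpa using e2
    obtain ⟨b, hb⟩ := IsAlgClosed.exists_pow_nat_eq (c 3) (n := 3) (by norm_num)
    refine ⟨0, b, ?_⟩
    ext i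
    fin_cases i <;> simp [cubeCoeff, h0, h1, h2, hb]
  · obtain ⟨a, ha⟩ := IsAlgClosed.exists_pow_nat_eq (c 0) (n := 3) (by norm_num)
    have ha0 : a ≠ 0 := by
      rintro rfl
      exact h0 (by simpa using ha.symm)
    obtain ⟨b, hb⟩ : ∃ b, c 1 = 3 * (a ^ 2 * b) := ⟨c 1 / (3 * a ^ 2), by field_simp⟩
    have h2 : c 2 = 3 * (a * b ^ 2) := by
      rw [← ha, hb] at e0
      refine mul_left_cancel₀ (mul_ne_zero h3 (pow_ne_zero 3 ha0)) ?_
      linear_combination e0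
    have hc3 : c 3 = b ^ 3 := by
      rw [← ha, hb, h2] at e1
      refine mul_left_cancel₀ (mul_ne_zero (mul_ne_zero h3 h3) (pow_ne_zero 3 ha0)) ?_
      linear_combination e1
    refine ⟨a, b, ?_⟩
    ext i
    fin_cases i <;> simp [cubeCoeff, ha, hb, h2, hc3]

/-- The quartic `s` has partials `a • c` and `b • c`. Comparing mixed derivatives puts (a, -b) in
the left kernel of a 2 × 3 matrix whose minors are, up to sign, the entries of `hessian c`; hence a
= b = 0. -/
theorem eq_zero_of_partial_eq_smul {k : Type*} [Field k] (h2 : (2 : k) ≠ 0)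
    {c : Fin 4 → k} (hc : hessian c ≠ 0) {s : Fin 5 → k} {a b : k}
    (hx : ![4 * s 0, 3 * s 1, 2 * s 2, s 3] = a • c)
    (hy : ![s 1, 2 * s 2, 3 * s 3, 4 * s 4] = b • c) : s = 0 := by
  have x0 : 4 * s 0 = a * c 0 := congrFun hx 0
  have x1 : 3 * s 1 = a * c 1 := congrFun hx 1
  have x2 : 2 * s 2 = a * c 2 := congrFun hx 2
  have x3 : s 3 = a * c 3 := congrFun hx 3
  have y0 : s 1 = b * c 0 := congrFun hy 0
  have y1 : 2 * s 2 = b * c 1 := congrFun hy 1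
  have y2 : 3 * s 3 = b * c 2 := congrFun hy 2
  have y3 : 4 * s 4 = b * c 3 := congrFun hy 3
  have r1 : a * c 1 = 3 * (b * c 0) := by linear_combination 3 * y0 - x1
  -- Both sides equal `2 * s 2`, so no division by 2 occurs.
  have r2 : a * c 2 = b * c 1 := by linear_combination y1 - x2
  have r3 : 3 * (a * c 3) = b * c 2 := by linear_combination y2 - 3 * x3
  have hab : a = 0 ∧ b = 0 := by
    by_contra hne
    apply hc
    have key : ∀ z, a * z = 0 → b * z = 0 → z = 0 := by
      intro z hz hz'
      by_contra hz0
      exact hne ⟨(mul_eq_zero.1 hz).resolve_right hz0, (mul_eq_zero.1 hz').resolve_right hz0⟩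
    ext i
    fin_cases i
    · refine key _ ?_ ?_
      · show a * (3 * (c 0 * c 2) - c 1 ^ 2) = 0
        linear_combination 3 * c 0 * r2 - c 1 * r1
      · show b * (3 * (c 0 * c 2) - c 1 ^ 2) = 0
        linear_combination c 1 * r2 - c 2 * r1
    · refine key _ ?_ ?_
      · show a * (9 * (c 0 * c 3) - c 1 * c 2) = 0
        linear_combination 3 * c 0 * r3 - c 2 * r1
      · show b * (9 * (c 0 * c 3) - c 1 * c 2) = 0
        linear_combination c 1 * r3 - 3 * c 3 * r1
    · refine key _ ?_ ?_
      · show a * (3 * (c 1 * c 3) - c 2 ^ 2) = 0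
        linear_combination c 1 * r3 - c 2 * r2
      · show b * (3 * (c 1 * c 3) - c 2 ^ 2) = 0
        linear_combination c 2 * r3 - 3 * c 3 * r2
  obtain ⟨rfl, rfl⟩ := hab
  have h4 : (4 : k) ≠ 0 := by
    have : (4 : k) = 2 * 2 := by norm_num
    rw [this]
    exact mul_ne_zero h2 h2
  simp only [zero_mul, mul_eq_zero, h2, h4, false_or] at x0 x2 x3 y0 y3
  ext i
  fin_cases i <;> simp [x0, x2, x3, y0, y3]

/-! ### Tangent directions and the orbit -/

/-- The coefficients of the degree `5` part of `f`. -/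
noncomputable def quinticCoeff {k : Type*} [Field k] (f : Module.Dual k (PS k 2)) (l : ℕ) : k :=
  f (mon k (5 - l) l)

/-- Since `f` kills 𝔪^6, only the degree `j` part of `σ` contributes, and only the quintic part of
`f` is seen. -/
theorem apply_mon_mul {k : Type*} [Field k] {f : Module.Dual k (PS k 2)}
    (hf : f ∈ vanishing k 2 6) {j u v : ℕ} (huv : u + v + j = 5) {σ : PS k 2}
    (hσ : σ ∈ maxIdeal k 2 ^ j) :
    f (mon k u v * σ) =
      ∑ l ∈ Finset.range (j + 1), coeff (bideg (j - l) l) σ * quinticCoeff f (l + v) := by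
  have h1 := Ideal.mul_mem_mul (mon_mem k (le_refl (u + v))) (sub_sum_mon_mem hσ)
  rw [← pow_add, show u + v + (j + 1) = 6 by omega] at h1
  have h2 := mem_vanishing.1 hf _ h1
  rw [mul_sub, map_sub, sub_eq_zero, Finset.mul_sum, map_sum] at h2
  rw [h2]
  refine Finset.sum_congr rfl fun l hl => ?_
  rw [Finset.mem_range] at hl
  rw [mul_smul_comm, map_smul, mon_mul_mon, smul_eq_mul, quinticCoeff,
    show 5 - (l + v) = u + (j - l) by omega, add_comm v l]

theorem contract_mem_vanishing {k : Type*} [Field k] {n d e : ℕ} {f : Module.Dual k (PS k n)}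
    (hf : f ∈ vanishing k n (d + e)) {s : PS k n} (hs : s ∈ maxIdeal k n ^ e) :
    contract s f ∈ vanishing k n d := by
  rw [mem_vanishing] at hf ⊢
  intro σ hσ
  refine hf _ ?_
  rw [pow_add]
  exact Ideal.mul_mem_mul hσ hs

theorem IsUnipotent.comp_mem_vanishing {k : Type*} [Field k] {n e : ℕ} {L : PS k n →ₗ[k] PS k n}
    (hL : IsUnipotent L) {g : Module.Dual k (PS k n)} (hg : g ∈ vanishing k n e) :
    g ∘ₗ L ∈ vanishing k n e :=
  mem_vanishing.2 fun _ hσ => mem_vanishing.1 hg _ (hL.map_mem hσ)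

theorem IsUnipotent.comp_sub_mem_vanishing {k : Type*} [Field k] {n e : ℕ}
    {L : PS k n →ₗ[k] PS k n} (hL : IsUnipotent L) {g : Module.Dual k (PS k n)}
    (hg : g ∈ vanishing k n (e + 1)) : g ∘ₗ L - g ∈ vanishing k n e :=
  mem_vanishing.2 fun σ hσ => by
    rw [LinearMap.sub_apply, LinearMap.comp_apply, ← map_sub]
    exact mem_vanishing.1 hg _ (hL e σ hσ)

/-- The leading forms, of degree `j`, of the tangent directions to the orbit of `f`. -/
def tangentForms {k : Type*} [Field k] {n : ℕ} (f : Module.Dual k (PS k n)) (j : ℕ) :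
    Submodule k (Module.Dual k (PS k n)) where
  carrier := {h | h ∈ vanishing k n (j + 1) ∧ ∀ t : k, ∃ L ∈ gPlus k n,
    f ∘ₗ (L : PS k n →ₗ[k] PS k n) - f - t • h ∈ vanishing k n j}
  zero_mem' := ⟨Submodule.zero_mem _, fun t => ⟨1, one_mem _, by
    simp⟩⟩
  add_mem' := by
    rintro h h' ⟨hv, hL⟩ ⟨hv', hL'⟩
    refine ⟨Submodule.add_mem _ hv hv', fun t => ?_⟩
    obtain ⟨L, hLm, hL⟩ := hL t
    obtain ⟨L', hLm', hL'⟩ := hL' t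
    refine ⟨L * L', mul_mem hLm hLm', ?_⟩
    have hu := isUnipotent_of_mem_gPlus hLm'
    -- The defect of `L * L'` is the defect of `L` moved by `L'`, plus the change of `t • h` under
    -- `L'`, plus the defect of `L'`.
    have h1 := hu.comp_mem_vanishing hL
    have h2 := hu.comp_sub_mem_vanishing (Submodule.smul_mem _ t hv)
    convert Submodule.add_mem _ (Submodule.add_mem _ h1 h2) hL' using 1
    ext τ
    simp
    ring
  smul_mem' := by
    rintro c h ⟨hv, hL⟩
    refine ⟨Submodule.smul_mem _ c hv, fun t => ?_⟩
    rw [smul_smul]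
    exact hL _

/-- Multiplication by 1 + ts changes `f` by exactly t(s ⌟ f). -/
theorem contract_mem_tangentForms {k : Type*} [Field k] {n : ℕ} {f : Module.Dual k (PS k n)}
    {j e : ℕ} (hf : f ∈ vanishing k n (j + 1 + e)) (he : e ≠ 0) {s : PS k n}
    (hs : s ∈ maxIdeal k n ^ e) : contract s f ∈ tangentForms f j := by
  refine ⟨contract_mem_vanishing hf hs, fun t => ?_⟩
  have hts : t • s ∈ maxIdeal k n := by
    rw [Algebra.smul_def]
    exact Ideal.mul_mem_left _ _ (Ideal.pow_le_self he hs)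
  obtain ⟨L, hL, h⟩ := exists_mem_gPlus_mul hts
  refine ⟨L, hL, ?_⟩
  convert Submodule.zero_mem _
  ext τ
  simp [h, contract, mul_comm]

/-- The automorphism αᵢ ↦ αᵢ + t dᵢ changes `f` by t times the transposed derivation, up to
functionals of degree below `j`; `1 ≤ r` puts the higher powers of t into that error. -/
theorem derivation_mem_tangentForms {k : Type*} [Field k] {f : Module.Dual k (PS k 2)}
    {j r : ℕ} (hr : 1 ≤ r) (hf : f ∈ vanishing k 2 (j + r + 1)) {d : Fin 2 → PS k 2}
    (hd : ∀ i, d i ∈ maxIdeal k 2 ^ (r + 1)) :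
    ∑ l ∈ Finset.range (j + 1), f (((j - l : ℕ) : k) • (mon k (j - l - 1) l * d 0) +
      (l : k) • (mon k (j - l) (l - 1) * d 1)) • dpMonomial k (bideg (j - l) l) ∈
        tangentForms f j := by
  constructor
  · refine Submodule.sum_mem _ fun l hl => Submodule.smul_mem _ _ (dpMonomial_mem_vanishing ?_)
    rw [Finset.mem_range] at hl
    rw [degree_bideg]
    omega
  · intro t
    have htd : ∀ i, t • d i ∈ maxIdeal k 2 ^ (r + 1) := fun i => by
      rw [Algebra.smul_def]
      exact Ideal.mul_mem_left _ _ (hd i)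
    obtain ⟨φ, hφ, hm⟩ := exists_algEquiv_X_add (d := fun i => t • d i)
      (fun i => Ideal.pow_le_pow_right (by omega) (htd i))
    refine ⟨_, hm, mem_vanishing.2 fun σ hσ => ?_⟩
    have h1 := mem_vanishing.1 hf _ (algHom_sub_sum_mem (φ := φ.toAlgHom) hr htd hφ hσ)
    rw [map_sub, map_sub, map_sum] at h1
    rw [← h1]
    have h2 : ∀ x : PS k 2, φ.toAlgHom x = φ x := fun _ => rfl
    simp only [LinearMap.sub_apply, LinearMap.comp_apply, LinearMap.smul_apply,
      LinearMap.sum_apply, LinearEquiv.coe_coe, AlgEquiv.toLinearEquiv_apply, h2, map_smul,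
      smul_eq_mul, Finset.mul_sum, dpMonomial, map_add, mul_smul_comm]
    congr 1
    refine Finset.sum_congr rfl fun l _ => ?_
    ring

/-- Padding with zeros multiplies a form by a power of α₁ and turns it into a quadric. -/
theorem NoQuadric.form_eq_zero {k : Type*} [Field k] {w : ℕ → k} (hq : NoQuadric w)
    {j : ℕ} (hj : j ≤ 2) {c : ℕ → k}
    (hm : ∀ v ≤ 5 - j, ∑ l ∈ Finset.range (j + 1), c l * w (l + v) = 0) : ∀ l ≤ j, c l = 0 := by
  interval_cases j
  · have := hq ![c 0, 0, 0] fun i hi => by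
      simpa using hm i (by omega)
    intro l hl
    interval_cases l
    exact congrFun this 0
  · have := hq ![c 0, c 1, 0] fun i hi => by
      have := hm i (by omega)
      simp only [Finset.sum_range_succ, Finset.sum_range_zero] at this
      simp only [Matrix.cons_val]
      rw [add_comm i 1]
      simpa using this
    intro l hl
    interval_cases l
    · exact congrFun this 0
    · exact congrFun this 1
  · have := hq ![c 0, c 1, c 2] fun i hi => by
      have := hm i (by omega)
      simp only [Finset.sum_range_succ, Finset.sum_range_zero] at this
      simp only [Matrix.cons_val]
      rw [add_comm i 1, add_comm i 2]
      simpa using this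
    intro l hl
    interval_cases l
    · exact congrFun this 0
    · exact congrFun this 1
    · exact congrFun this 2

/-- `hm` says that the form `c` kills the quintic, `hx` and `hy` that its two partial derivatives
do. At `l = 0` the truncated `l - 1` has coefficient zero. -/
theorem form_eq_zero_of_tangent {k : Type*} [Field k] (h2 : (2 : k) ≠ 0) (h3 : (3 : k) ≠ 0)
    {w : ℕ → k} (hw : hessian (apolarCubic w) ≠ 0) {j : ℕ} (hj : j ≤ 4) {c : ℕ → k}
    (hm : ∀ v ≤ 5 - j, ∑ l ∈ Finset.range (j + 1), c l * w (l + v) = 0)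
    (hx : ∀ v ≤ 6 - j, ∑ l ∈ Finset.range (j + 1), c l * (((j - l : ℕ) : k) * w (l + v)) = 0)
    (hy : ∀ v ≤ 6 - j, ∑ l ∈ Finset.range (j + 1), c l * ((l : k) * w (l - 1 + v)) = 0) :
    ∀ l ≤ j, c l = 0 := by
  have hC := apolarCubic_ne_zero_of_hessian hw
  have hq := noQuadric_of_apolarCubic_ne_zero hC
  rcases le_or_gt j 2 with hj2 | hj2
  · exact hq.form_eq_zero hj2 hm
  interval_cases j
  · have e1 := hq ![3 * c 0, 2 * c 1, c 2] fun i hi => by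
      have := hx i (by omega)
      simp [Finset.sum_range_succ] at this
      simp only [Matrix.cons_val]
      rw [add_comm i 1, add_comm i 2]
      linear_combination this
    have e2 := hq ![c 1, 2 * c 2, 3 * c 3] fun i hi => by
      have := hy i (by omega)
      simp [Finset.sum_range_succ] at this
      simp only [Matrix.cons_val]
      rw [add_comm i 1, add_comm i 2]
      linear_combination this
    intro l hl
    interval_cases l
    · exact (mul_eq_zero.1 (congrFun e1 0)).resolve_left h3
    · exact congrFun e2 0
    · exact congrFun e1 2
    · exact (mul_eq_zero.1 (congrFun e2 2)).resolve_left h3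
  · obtain ⟨a, ha⟩ := HankelKer.exists_eq_smul (w := w)
      (c := ![4 * c 0, 3 * c 1, 2 * c 2, c 3]) (fun i hi => by
        have := hx i (by omega)
        simp [Finset.sum_range_succ] at this
        simp only [Matrix.cons_val]
        rw [add_comm i 1, add_comm i 2, add_comm i 3]
        linear_combination this) hC
    obtain ⟨b, hb⟩ := HankelKer.exists_eq_smul (w := w)
      (c := ![c 1, 2 * c 2, 3 * c 3, 4 * c 4]) (fun i hi => by
        have := hy i (by omega)
        simp [Finset.sum_range_succ] at this
        simp only [Matrix.cons_val]
        rw [add_comm i 1, add_comm i 2, add_comm i 3]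
        linear_combination this) hC
    have := eq_zero_of_partial_eq_smul h2 hw (s := fun i => c i) ha hb
    intro l hl
    exact congrFun this ⟨l, by omega⟩

theorem vanishing_le_tangentForms {k : Type*} [Field k] (h2 : (2 : k) ≠ 0) (h3 : (3 : k) ≠ 0)
    {f : Module.Dual k (PS k 2)} (hf : f ∈ vanishing k 2 6)
    (hw : hessian (apolarCubic (quinticCoeff f)) ≠ 0) {j : ℕ} (hj : j ≤ 4) :
    vanishing k 2 (j + 1) ≤ tangentForms f j := by
  have hle : tangentForms f j ≤ vanishing k 2 (j + 1) := fun _ h => h.1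
  have := Submodule.finiteDimensional_of_le hle
  refine vanishing_le_of_forall fun σ hσ => ?_
  -- Taking `L = 1`, functionals of degree below `j` are among the tangent forms, so only the degree
  -- `j` part of `σ` is still in question.
  have hσj : σ ∈ maxIdeal k 2 ^ j := by
    rw [← mem_dualCoannihilator_vanishing, Submodule.mem_dualCoannihilator]
    refine fun g hg => hσ g ⟨vanishing_mono (Nat.le_succ j) hg, fun t => ⟨1, one_mem _, ?_⟩⟩
    have h1 : f ∘ₗ ((1 : PS k 2 ≃ₗ[k] PS k 2) : PS k 2 →ₗ[k] PS k 2) = f := rfl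
    rw [h1, sub_self, zero_sub]
    exact Submodule.neg_mem _ (Submodule.smul_mem _ t hg)
  have hfr : f ∈ vanishing k 2 (j + (5 - j) + 1) := by
    rwa [show j + (5 - j) + 1 = 6 by omega]
  have hmon : ∀ {v}, v ≤ 6 - j → mon k (6 - j - v) v ∈ maxIdeal k 2 ^ (5 - j + 1) := fun h =>
    mon_mem k (by omega)
  have key := form_eq_zero_of_tangent h2 h3 hw hj (c := fun l => coeff (bideg (j - l) l) σ)
    (fun v hv => by
      rw [← apply_mon_mul hf (show 5 - j - v + v + j = 5 by omega) hσj, mul_comm]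
      refine hσ _ (contract_mem_tangentForms (e := 5 - j) ?_ (by omega) (mon_mem k (by omega)))
      rwa [show j + 1 + (5 - j) = 6 by omega])
    (fun v hv => by
      -- The derivation is a monomial of degree 6 - j times ∂/∂α₁, so that it sends degree `j` to
      -- degree 5.
      have h1 := hσ _ (derivation_mem_tangentForms (by omega) hfr
        (d := ![mon k (6 - j - v) v, 0]) (fun i => by
          fin_cases i
          · exact hmon hv
          · exact Ideal.zero_mem _))
      rw [LinearMap.sum_apply] at h1
      rw [← h1]
      refine Finset.sum_congr rfl fun l hl => ?_
      rw [Finset.mem_range] at hl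
      simp only [Matrix.cons_val, mul_zero, smul_zero, add_zero, map_smul, LinearMap.smul_apply,
        smul_eq_mul, dpMonomial, mon_mul_mon]
      rw [mul_comm]
      congr 1
      rcases Nat.eq_zero_or_pos (j - l) with h0 | h0
      · simp [h0]
      · rw [quinticCoeff, show 5 - (l + v) = j - l - 1 + (6 - j - v) by omega])
    (fun v hv => by
      have h1 := hσ _ (derivation_mem_tangentForms (by omega) hfr
        (d := ![0, mon k (6 - j - v) v]) (fun i => by
          fin_cases i
          · exact Ideal.zero_mem _
          · exact hmon hv))
      rw [LinearMap.sum_apply] at h1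
      rw [← h1]
      refine Finset.sum_congr rfl fun l hl => ?_
      rw [Finset.mem_range] at hl
      simp only [Matrix.cons_val, mul_zero, smul_zero, zero_add, map_smul, LinearMap.smul_apply,
        smul_eq_mul, dpMonomial, mon_mul_mon]
      rw [mul_comm]
      congr 1
      rcases Nat.eq_zero_or_pos l with h0 | h0
      · simp [h0]
      · rw [quinticCoeff, show 5 - (l - 1 + v) = j - l + (6 - j - v) by omega])
  have h1 := sub_sum_mon_mem hσj
  rwa [Finset.sum_eq_zero, sub_zero] at h1
  intro l hl
  rw [key l (by rw [Finset.mem_range] at hl; omega), zero_smul]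

/-- A group element matching the leading form of `g - f` is undone on `g`, which leaves a difference
of smaller degree. -/
theorem gPlusOrbit_eq {k : Type*} [Field k] (h2 : (2 : k) ≠ 0) (h3 : (3 : k) ≠ 0)
    {f : Module.Dual k (PS k 2)} (hf : f ∈ vanishing k 2 6)
    (hw : hessian (apolarCubic (quinticCoeff f)) ≠ 0) :
    gPlusOrbit f = {g | g - f ∈ vanishing k 2 5} := by
  ext g
  constructor
  · rintro ⟨L, hL, rfl⟩
    exact (isUnipotent_of_mem_gPlus hL).comp_sub_mem_vanishing hf
  · suffices ∀ j ≤ 5, ∀ g, g - f ∈ vanishing k 2 j → g ∈ gPlusOrbit f from this 5 le_rfl g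
    intro j
    induction j with
    | zero =>
      intro _ g hg
      refine ⟨1, one_mem _, ?_⟩
      ext τ
      have := mem_vanishing.1 hg τ (by simp)
      rwa [LinearMap.sub_apply, sub_eq_zero] at this
    | succ j ih =>
      intro hj g hg
      obtain ⟨L, hL, h⟩ := (vanishing_le_tangentForms h2 h3 hf hw (by omega) hg).2 1
      have hinv := isUnipotent_of_mem_gPlus (inv_mem hL)
      obtain ⟨L', hL', h'⟩ := ih (by omega)
        (g ∘ₗ ((L⁻¹ : PS k 2 ≃ₗ[k] PS k 2) : PS k 2 →ₗ[k] PS k 2)) (by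
          have h1 := Submodule.neg_mem _ (hinv.comp_mem_vanishing h)
          convert h1 using 1
          ext τ
          simp)
      refine ⟨L' * L, mul_mem hL' hL, ?_⟩
      ext τ
      have h1 := LinearMap.congr_fun h' (L τ)
      have hs : L⁻¹ (L τ) = τ := L.symm_apply_apply τ
      simpa [hs] using h1

/-! ### The Hilbert function of an apolar algebra -/

theorem finrank_quotient_smul_top_add {k A : Type*} [Field k] [CommRing A] [Algebra k A]
    [FiniteDimensional k A] (I J : Ideal A) :
    Module.finrank k (I ⧸ (J • ⊤ : Submodule A I)) + Module.finrank k (J * I : Ideal A) =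
      Module.finrank k I := by
  have hI : FiniteDimensional k I :=
    inferInstanceAs (FiniteDimensional k (I.restrictScalars k : Submodule k A))
  have h1 := Submodule.finrank_quotient_add_finrank
    ((J • ⊤ : Submodule A I).restrictScalars k)
  rw [(Submodule.Quotient.restrictScalarsEquiv k (J • ⊤ : Submodule A I)).finrank_eq] at h1
  rw [← h1]
  congr 1
  have h2 : Submodule.map I.subtype (J • ⊤ : Submodule A I) = J * I := by
    rw [Submodule.map_smul'', Submodule.map_top, Submodule.range_subtype, smul_eq_mul]
  rw [← h2]
  exact ((Submodule.equivMapOfInjective I.subtype I.injective_subtype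
    (J • ⊤ : Submodule A I)).restrictScalars k).finrank_eq.symm

/-- The Hilbert function becomes the successive drops of dim 𝔪_A^i, which can be computed inside the
dual space as dim 𝔪^i ⌟ f. -/
theorem hasHilbertFunction_iff {k A : Type*} [Field k] [CommRing A] [Algebra k A]
    [FiniteDimensional k A] {H : ℕ → ℕ} :
    HasHilbertFunction k A H ↔ ∃ _ : IsLocalRing A, ∀ i,
      H i + Module.finrank k (IsLocalRing.maximalIdeal A ^ (i + 1) : Ideal A) =
        Module.finrank k (IsLocalRing.maximalIdeal A ^ i : Ideal A) := by
  refine exists_congr fun _ => forall_congr' fun i => ?_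
  rw [← finrank_quotient_smul_top_add (k := k) (IsLocalRing.maximalIdeal A ^ i)
    (IsLocalRing.maximalIdeal A), pow_succ', Nat.add_right_cancel_iff, eq_comm]

/-- The map `σ ↦ σ ⌟ f`. -/
noncomputable def contractLin {k : Type*} [Field k] {n : ℕ} (f : Module.Dual k (PS k n)) :
    PS k n →ₗ[k] Module.Dual k (PS k n) where
  toFun σ := contract σ f
  map_add' σ τ := by
    ext ρ
    simp [contract, mul_add]
  map_smul' c σ := by
    ext ρ
    simp [contract]

/-- The embedding of `Apolar f` into the functionals, with image `S ⌟ f`. -/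
noncomputable def apolarEmb {k : Type*} [Field k] {n : ℕ} (f : Module.Dual k (PS k n)) :
    Apolar f →ₗ[k] Module.Dual k (PS k n) :=
  (((apolarIdeal f).restrictScalars k).liftQ (contractLin f) (fun _ h => h)) ∘ₗ
    (Submodule.Quotient.restrictScalarsEquiv k (apolarIdeal f)).symm.toLinearMap

theorem apolarEmb_injective {k : Type*} [Field k] {n : ℕ} (f : Module.Dual k (PS k n)) :
    Function.Injective (apolarEmb f) := by
  rw [injective_iff_map_eq_zero]
  intro a ha
  obtain ⟨σ, rfl⟩ := Ideal.Quotient.mk_surjective a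
  exact Ideal.Quotient.eq_zero_iff_mem.2 ha

/-- The space `𝔪 ^ i ⌟ f`. -/
noncomputable def contractPow {k : Type*} [Field k] {n : ℕ} (f : Module.Dual k (PS k n)) (i : ℕ) :
    Submodule k (Module.Dual k (PS k n)) :=
  ((maxIdeal k n ^ i).restrictScalars k).map (contractLin f)

theorem contractPow_le_vanishing {k : Type*} [Field k] {n d : ℕ} {f : Module.Dual k (PS k n)}
    (hf : f ∈ vanishing k n d) (i : ℕ) : contractPow f i ≤ vanishing k n (d - i) := by
  rintro _ ⟨s, hs, rfl⟩
  rcases le_total i d with h | h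
  · exact contract_mem_vanishing (d := d - i) (e := i) (by rwa [Nat.sub_add_cancel h]) hs
  · rw [Nat.sub_eq_zero_of_le h]
    exact contract_mem_vanishing (d := 0) (e := d) (by rwa [zero_add])
      (Ideal.pow_le_pow_right h hs)

theorem finiteDimensional_apolar {k : Type*} [Field k] {n d : ℕ} {f : Module.Dual k (PS k n)}
    (hf : f ∈ vanishing k n d) : FiniteDimensional k (Apolar f) := by
  have h : LinearMap.range (apolarEmb f) ≤ vanishing k n d := by
    rintro _ ⟨a, rfl⟩
    obtain ⟨σ, rfl⟩ := Ideal.Quotient.mk_surjective a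
    exact contractPow_le_vanishing hf 0 ⟨σ, by simp, rfl⟩
  have := Submodule.finiteDimensional_of_le h
  exact Module.Finite.equiv (LinearEquiv.ofInjective _ (apolarEmb_injective f)).symm

theorem maximalIdeal_apolar_pow {k : Type*} [Field k] {n : ℕ} (f : Module.Dual k (PS k n))
    [IsLocalRing (Apolar f)] (i : ℕ) : IsLocalRing.maximalIdeal (Apolar f) ^ i =
      (maxIdeal k n ^ i).map (Ideal.Quotient.mk (apolarIdeal f)) := by
  rw [Ideal.map_pow, IsLocalRing.map_maximalIdeal_of_surjective _ Ideal.Quotient.mk_surjective]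

theorem finrank_maximalIdeal_apolar_pow {k : Type*} [Field k] {n : ℕ}
    (f : Module.Dual k (PS k n)) [IsLocalRing (Apolar f)] (i : ℕ) :
    Module.finrank k (IsLocalRing.maximalIdeal (Apolar f) ^ i : Ideal (Apolar f)) =
      Module.finrank k (contractPow f i) := by
  have h : ((IsLocalRing.maximalIdeal (Apolar f) ^ i).restrictScalars k).map (apolarEmb f) =
      contractPow f i := by
    rw [maximalIdeal_apolar_pow]
    apply le_antisymm
    · rintro _ ⟨a, ha, rfl⟩
      obtain ⟨σ, hσ, rfl⟩ := (Ideal.mem_map_iff_of_surjective _ Ideal.Quotient.mk_surjective).1 ha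
      exact ⟨σ, hσ, rfl⟩
    · rintro _ ⟨σ, hσ, rfl⟩
      exact ⟨_, Ideal.mem_map_of_mem _ hσ, rfl⟩
  rw [← h]
  exact (Submodule.equivMapOfInjective (apolarEmb f) (apolarEmb_injective f)
    ((IsLocalRing.maximalIdeal (Apolar f) ^ i).restrictScalars k)).finrank_eq

theorem hasHilbertFunction_apolar_iff {k : Type*} [Field k] {n d : ℕ}
    {f : Module.Dual k (PS k n)} (hf : f ∈ vanishing k n d) {H : ℕ → ℕ} :
    HasHilbertFunction k (Apolar f) H ↔ IsLocalRing (Apolar f) ∧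
      ∀ i, H i + Module.finrank k (contractPow f (i + 1)) =
        Module.finrank k (contractPow f i) := by
  have := finiteDimensional_apolar hf
  rw [hasHilbertFunction_iff, ← exists_prop]
  refine exists_congr fun _ => forall_congr' fun i => ?_
  rw [← finrank_maximalIdeal_apolar_pow, ← finrank_maximalIdeal_apolar_pow]

theorem finrank_quotient_maxIdeal_pow {k : Type*} [Field k] {n : ℕ} (e : ℕ) :
    Module.finrank k (PS k n ⧸ maxIdeal k n ^ e) = Module.finrank k (vanishing k n e) := by
  rw [vanishing, ← (Submodule.dualQuotEquivDualAnnihilator _).finrank_eq, Subspace.dual_finrank_eq,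
    (Submodule.Quotient.restrictScalarsEquiv k (maxIdeal k n ^ e)).finrank_eq]

/-- As long as Ann(f) ⊆ 𝔪^i, the quotient A/𝔪_A^i is the whole of S/𝔪^i. -/
theorem finrank_contractPow_add {k : Type*} [Field k] {n d : ℕ} {f : Module.Dual k (PS k n)}
    (hf : f ∈ vanishing k n d) [IsLocalRing (Apolar f)] {i : ℕ}
    (hi : apolarIdeal f ≤ maxIdeal k n ^ i) :
    Module.finrank k (vanishing k n i) + Module.finrank k (contractPow f i) =
      Module.finrank k (Apolar f) := by
  have := finiteDimensional_apolar hf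
  rw [← finrank_maximalIdeal_apolar_pow, ← finrank_quotient_maxIdeal_pow,
    ← (DoubleQuot.quotQuotEquivQuotOfLEₐ k hi).toLinearEquiv.finrank_eq, maximalIdeal_apolar_pow]
  have h1 := Submodule.finrank_quotient_add_finrank
    (((maxIdeal k n ^ i).map (Ideal.Quotient.mk (apolarIdeal f))).restrictScalars k)
  rw [(Submodule.Quotient.restrictScalarsEquiv k
    ((maxIdeal k n ^ i).map (Ideal.Quotient.mk (apolarIdeal f)))).finrank_eq] at h1
  exact h1

/-- If `σ` lies in 𝔪^j with j ≤ 5 - i, the monomials of degree 5 - j ≥ i show that its degree `j`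
form kills f_5. Here j ≤ 2, so that form is zero. -/
theorem NoQuadric.mem_maxIdeal_pow {k : Type*} [Field k] {f : Module.Dual k (PS k 2)}
    (hf : f ∈ vanishing k 2 6) (hq : NoQuadric (quinticCoeff f)) {i : ℕ} (hi : 3 ≤ i)
    {σ : PS k 2} (hσ : ∀ s ∈ maxIdeal k 2 ^ i, f (s * σ) = 0) : σ ∈ maxIdeal k 2 ^ (6 - i) := by
  suffices ∀ j ≤ 6 - i, σ ∈ maxIdeal k 2 ^ j from this _ le_rfl
  intro j
  induction j with
  | zero => simp
  | succ j ih =>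
    intro hj
    have hσj := ih (by omega)
    have key := hq.form_eq_zero (j := j) (by omega) (c := fun l => coeff (bideg (j - l) l) σ)
      fun v hv => by
        rw [← apply_mon_mul hf (show 5 - j - v + v + j = 5 by omega) hσj]
        exact hσ _ (mon_mem k (by omega))
    have h1 := sub_sum_mon_mem hσj
    rwa [Finset.sum_eq_zero, sub_zero] at h1
    intro l hl
    rw [key l (by rw [Finset.mem_range] at hl; omega), zero_smul]

theorem NoQuadric.contractPow_eq {k : Type*} [Field k] {f : Module.Dual k (PS k 2)}
    (hf : f ∈ vanishing k 2 6) (hq : NoQuadric (quinticCoeff f)) {i : ℕ} (hi : 3 ≤ i) :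
    contractPow f i = vanishing k 2 (6 - i) := by
  have hle := contractPow_le_vanishing hf i
  have := Submodule.finiteDimensional_of_le hle
  refine le_antisymm hle (vanishing_le_of_forall fun σ hσ => ?_)
  refine hq.mem_maxIdeal_pow hf hi fun s hs => ?_
  rw [mul_comm]
  exact hσ _ ⟨s, hs, rfl⟩

theorem NoQuadric.apolarIdeal_le {k : Type*} [Field k] {f : Module.Dual k (PS k 2)}
    (hf : f ∈ vanishing k 2 6) (hq : NoQuadric (quinticCoeff f)) :
    apolarIdeal f ≤ maxIdeal k 2 ^ 3 := fun _ hσ =>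
  hq.mem_maxIdeal_pow hf le_rfl fun s _ => mem_apolarIdeal.1 hσ s

/-- The dimensions are known from both ends: 𝔪^i ⌟ f = P_{≤5-i} for i ≥ 3, and Ann(f) ⊆ 𝔪³ gives the
codimension of 𝔪_A^i for i ≤ 3. The two agree at i = 3, where 6 + 6 = 12 is the dimension of the
algebra. -/
theorem NoQuadric.hasHilbertFunction {k : Type*} [Field k] {f : Module.Dual k (PS k 2)}
    (hf : f ∈ vanishing k 2 6) (hq : NoQuadric (quinticCoeff f)) :
    HasHilbertFunction k (Apolar f) h123321 := by
  have hle := hq.apolarIdeal_le hf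
  have : Nontrivial (Apolar f) := Ideal.Quotient.nontrivial_iff.2 fun h => by
    rw [h, top_le_iff, Ideal.eq_top_iff_one] at hle
    exact (IsLocalRing.maximalIdeal.isMaximal (PS k 2)).ne_top
      ((Ideal.eq_top_iff_one _).2 (Ideal.pow_le_self (by norm_num) hle))
  have hloc : IsLocalRing (Apolar f) := IsLocalRing.of_surjective' _ Ideal.Quotient.mk_surjective
  have hbig : ∀ i, 3 ≤ i → Module.finrank k (contractPow f i) = (6 - i) * (6 - i + 1) / 2 :=
    fun i hi => by rw [hq.contractPow_eq hf hi, finrank_vanishing_two]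
  have hsmall : ∀ i, i ≤ 3 → i * (i + 1) / 2 + Module.finrank k (contractPow f i) =
      Module.finrank k (Apolar f) := fun i hi => by
    rw [← finrank_contractPow_add hf (hle.trans (Ideal.pow_le_pow_right hi)),
      finrank_vanishing_two]
  refine (hasHilbertFunction_apolar_iff hf).2 ⟨hloc, fun i => ?_⟩
  obtain ⟨δ, hδ⟩ : ∃ δ : ℕ → ℕ, ∀ i, Module.finrank k (contractPow f i) = δ i := ⟨_, fun _ => rfl⟩
  simp only [hδ] at hbig hsmall ⊢
  have s0 := hsmall 0 (by norm_num)
  have s1 := hsmall 1 (by norm_num)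
  have s2 := hsmall 2 (by norm_num)
  have s3 := hsmall 3 (by norm_num)
  have b3 := hbig 3 (by norm_num)
  have b4 := hbig 4 (by norm_num)
  have b5 := hbig 5 (by norm_num)
  have b6 := hbig 6 (by norm_num)
  norm_num at s0 s1 s2 s3 b3 b4 b5 b6
  rcases lt_or_ge i 6 with hi | hi
  · interval_cases i <;> norm_num [h123321] <;> omega
  · have b1 := hbig i (by omega)
    have b2 := hbig (i + 1) (by omega)
    rw [Nat.sub_eq_zero_of_le hi] at b1
    rw [Nat.sub_eq_zero_of_le (by omega)] at b2
    have : h123321 i = 0 := List.getD_eq_default _ _ hi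
    omega

/-- The last three values give dim 𝔪³ ⌟ f = 3 + 2 + 1 = dim P_{≤2}, so 𝔪³ ⌟ f is all of P_{≤2}. A
quadric killing f_5 is orthogonal to it, hence zero. -/
theorem noQuadric_of_hasHilbertFunction {k : Type*} [Field k] {f : Module.Dual k (PS k 2)}
    (hf : f ∈ vanishing k 2 6) (h : HasHilbertFunction k (Apolar f) h123321) :
    NoQuadric (quinticCoeff f) := by
  obtain ⟨hloc, h⟩ := (hasHilbertFunction_apolar_iff hf).1 h
  have h6 : Module.finrank k (contractPow f 6) = 0 := by
    have := Submodule.finrank_mono (contractPow_le_vanishing hf 6)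
    rw [finrank_vanishing_two] at this
    simpa using this
  have h3 : Module.finrank k (contractPow f 3) = 6 := by
    obtain ⟨δ, hδ⟩ : ∃ δ : ℕ → ℕ, ∀ i, Module.finrank k (contractPow f i) = δ i :=
      ⟨_, fun _ => rfl⟩
    simp only [hδ] at h h6 ⊢
    have e3 := h 3
    have e4 := h 4
    have e5 := h 5
    norm_num [h123321] at e3 e4 e5
    omega
  have heq : contractPow f 3 = vanishing k 2 3 :=
    Submodule.eq_of_le_of_finrank_eq (contractPow_le_vanishing hf 3) (by
      rw [h3, finrank_vanishing_two])
  intro q hq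
  set σ : PS k 2 := q 0 • mon k 2 0 + q 1 • mon k 1 1 + q 2 • mon k 0 2 with hσ
  have hzero : ∀ g ∈ vanishing k 2 3, g σ = 0 := by
    rw [← heq]
    rintro _ ⟨s, hs, rfl⟩
    show f (σ * s) = 0
    rw [hσ, add_mul, add_mul, map_add, map_add, smul_mul_assoc, smul_mul_assoc, smul_mul_assoc,
      map_smul, map_smul, map_smul, apply_mon_mul hf (j := 3) (by norm_num) hs,
      apply_mon_mul hf (j := 3) (by norm_num) hs, apply_mon_mul hf (j := 3) (by norm_num) hs]
    simp only [smul_eq_mul, Finset.mul_sum]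
    rw [← Finset.sum_add_distrib, ← Finset.sum_add_distrib]
    refine Finset.sum_eq_zero fun l hl => ?_
    have := hq l (by simpa using hl)
    rw [add_zero]
    linear_combination coeff (bideg (3 - l) l) s * this
  have hcoeff : ∀ a b, a + b < 3 → coeff (bideg a b) σ = 0 := fun a b hab =>
    hzero _ (dpMonomial_mem_vanishing (by rwa [degree_bideg]))
  ext r
  fin_cases r
  · simpa [hσ, coeff_bideg_mon] using hcoeff 2 0 (by norm_num)
  · simpa [hσ, coeff_bideg_mon] using hcoeff 1 1 (by norm_num)
  · simpa [hσ, coeff_bideg_mon] using hcoeff 0 2 (by norm_num)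

/-! ### Homogeneous parts -/

theorem homogeneousComponent_sub_mem {k : Type*} [Field k] {n d : ℕ} {σ : PS k n}
    (hσ : σ ∈ maxIdeal k n ^ d) : σ - homogeneousComponent d σ ∈ maxIdeal k n ^ (d + 1) := by
  rw [mem_maxIdeal_pow_iff] at hσ ⊢
  intro a ha
  rw [map_sub, coeff_homogeneousComponent]
  split_ifs with h
  · exact sub_self _
  · rw [hσ a (by omega), sub_zero]

theorem homPart_mem_vanishing {k : Type*} [Field k] {n : ℕ} (d : ℕ) (f : Module.Dual k (PS k n)) :
    homPart d f ∈ vanishing k n (d + 1) := by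
  rw [mem_vanishing]
  intro σ hσ
  have : homogeneousComponent d σ = 0 := by
    ext a
    rw [coeff_homogeneousComponent]
    split_ifs with h
    · rw [mem_maxIdeal_pow_iff.1 hσ a (by omega), map_zero]
    · simp
  rw [homPart, LinearMap.comp_apply, this, map_zero]

theorem sub_homPart_mem_vanishing {k : Type*} [Field k] {n d : ℕ} {f : Module.Dual k (PS k n)}
    (hf : f ∈ vanishing k n (d + 1)) : f - homPart d f ∈ vanishing k n d := by
  rw [mem_vanishing] at hf ⊢
  intro σ hσ
  rw [LinearMap.sub_apply, homPart, LinearMap.comp_apply, ← map_sub]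
  exact hf _ (homogeneousComponent_sub_mem hσ)

theorem homogeneousComponent_mon {k : Type*} [Field k] {a b d : ℕ} (h : a + b = d) :
    homogeneousComponent d (mon k a b) = mon k a b := by
  ext x
  rw [coeff_homogeneousComponent]
  split_ifs with hx
  · rfl
  · rw [← bideg_eta x, coeff_bideg_mon, if_neg]
    rintro ⟨h0, h1⟩
    rw [degree_eq_add] at hx
    omega

theorem quinticCoeff_homPart {k : Type*} [Field k] {f : Module.Dual k (PS k 2)}
    (hf : f ∈ vanishing k 2 6) : quinticCoeff (homPart 5 f) = quinticCoeff f := by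
  ext l
  rw [quinticCoeff, quinticCoeff]
  rcases le_or_gt l 5 with h | h
  · rw [homPart, LinearMap.comp_apply, homogeneousComponent_mon (by omega)]
  · have hm : mon k (5 - l) l ∈ maxIdeal k 2 ^ 6 := mon_mem k (by omega)
    rw [mem_vanishing.1 hf _ hm, mem_vanishing.1 (homPart_mem_vanishing 5 f) _ hm]

/-! ### Associated graded rings and canonical gradings -/

theorem coeff_mem_of_mem_map_reesAlgebra {A : Type*} [CommRing A] {I : Ideal A}
    {x : reesAlgebra I} (hx : x ∈ I.map (algebraMap A (reesAlgebra I))) (i : ℕ) :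
    (x : Polynomial A).coeff i ∈ I ^ (i + 1) := by
  revert i
  refine Submodule.span_induction
    (p := fun (x : reesAlgebra I) _ => ∀ i, (x : Polynomial A).coeff i ∈ I ^ (i + 1)) ?_ ?_ ?_ ?_ hx
  · rintro _ ⟨a, ha, rfl⟩ i
    show (Polynomial.C a).coeff i ∈ _
    rw [Polynomial.coeff_C]
    split_ifs with h
    · rw [h, zero_add, pow_one]
      exact ha
    · exact Ideal.zero_mem _
  · simp
  · intro x y _ _ hx hy i
    rw [Subalgebra.coe_add, Polynomial.coeff_add]
    exact Ideal.add_mem _ (hx i) (hy i)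
  · intro r y _ hy i
    rw [smul_eq_mul, Subalgebra.coe_mul, Polynomial.coeff_mul]
    refine Ideal.sum_mem _ fun p hp => ?_
    rw [Finset.HasAntidiagonal.mem_antidiagonal] at hp
    have := Ideal.mul_mem_mul (r.2 p.1) (hy p.2)
    rwa [← pow_add, ← add_assoc, hp] at this

theorem monomial_mem_map_reesAlgebra {A : Type*} [CommRing A] {I : Ideal A} {i : ℕ} {a : A}
    (ha : a ∈ I ^ (i + 1)) (h : Polynomial.monomial i a ∈ reesAlgebra I) :
    (⟨Polynomial.monomial i a, h⟩ : reesAlgebra I) ∈ I.map (algebraMap A (reesAlgebra I)) := by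
  suffices ∃ x ∈ I.map (algebraMap A (reesAlgebra I)), (x : Polynomial A) =
      Polynomial.monomial i a by
    obtain ⟨x, hx, hxa⟩ := this
    have : x = ⟨Polynomial.monomial i a, h⟩ := Subtype.ext hxa
    rwa [← this]
  rw [pow_succ'] at ha
  refine Submodule.mul_induction_on ha (fun b hb c hc => ?_) (fun b c hb hc => ?_)
  · refine ⟨algebraMap A (reesAlgebra I) b *
      ⟨Polynomial.monomial i c, reesAlgebra.monomial_mem.2 hc⟩,
      Ideal.mul_mem_right _ _ (Ideal.mem_map_of_mem _ hb), ?_⟩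
    show Polynomial.C b * Polynomial.monomial i c = _
    rw [Polynomial.C_mul_monomial]
  · obtain ⟨x, hx, hxb⟩ := hb
    obtain ⟨y, hy, hyc⟩ := hc
    exact ⟨x + y, Ideal.add_mem _ hx hy, by rw [Subalgebra.coe_add, hxb, hyc, map_add]⟩

/-- The homomorphism from the polynomial ring to the Rees algebra of `I` that sends `X i` to
`π (X i) * t`. -/
noncomputable def toRees {k A ι : Type*} [Field k] [CommRing A] [Algebra k A] (I : Ideal A)
    (π : MvPolynomial ι k →ₐ[k] A) (hI : ∀ i, π (MvPolynomial.X i) ∈ I) :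
    MvPolynomial ι k →ₐ[k] reesAlgebra I :=
  MvPolynomial.aeval fun i => ⟨Polynomial.monomial 1 (π (MvPolynomial.X i)),
    reesAlgebra.monomial_mem.2 (by rw [pow_one]; exact hI i)⟩

theorem coeff_toRees {k A ι : Type*} [Field k] [CommRing A] [Algebra k A] (I : Ideal A)
    (π : MvPolynomial ι k →ₐ[k] A) (hI : ∀ i, π (MvPolynomial.X i) ∈ I)
    (p : MvPolynomial ι k) (i : ℕ) :
    (toRees I π hI p : Polynomial A).coeff i = π (MvPolynomial.homogeneousComponent i p) := by
  induction p using MvPolynomial.induction_on' with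
  | monomial u a =>
    have key : ∃ n, (MvPolynomial.monomial u a).IsHomogeneous n ∧
        (toRees I π hI (MvPolynomial.monomial u a) : Polynomial A) =
          Polynomial.monomial n (π (MvPolynomial.monomial u a)) := by
      refine MvPolynomial.induction_on_monomial (motive := fun p => ∃ n, p.IsHomogeneous n ∧
        (toRees I π hI p : Polynomial A) = Polynomial.monomial n (π p)) ?_ ?_ u a
      · intro a
        refine ⟨0, MvPolynomial.isHomogeneous_C _ _, ?_⟩
        rw [← MvPolynomial.algebraMap_eq, AlgHom.commutes, AlgHom.commutes]
        rfl
      · rintro p i ⟨n, hp, h⟩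
        refine ⟨n + 1, hp.mul (MvPolynomial.isHomogeneous_X _ _), ?_⟩
        rw [map_mul, map_mul, Subalgebra.coe_mul, h, toRees, MvPolynomial.aeval_X,
          Polynomial.monomial_mul_monomial]
    obtain ⟨n, hn, h⟩ := key
    rw [h, Polynomial.coeff_monomial, MvPolynomial.homogeneousComponent_of_mem
      ((MvPolynomial.mem_homogeneousSubmodule _ _).2 hn)]
    by_cases hin : n = i
    · simp [hin]
    · rw [if_neg hin, if_neg (Ne.symm hin), map_zero]
  | add p q hp hq => rw [map_add, Subalgebra.coe_add, Polynomial.coeff_add, hp, hq, map_add, map_add]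

/-- The polynomial ring maps onto both algebras with the same kernel: `hker` gives one inclusion,
and `hgr`, which keeps the image of a form from falling into a deeper power of `I` unless it is
zero, gives the other. -/
theorem nonempty_algEquiv_assocGraded {k A ι : Type*} [Field k] [CommRing A] [Algebra k A]
    {I : Ideal A} {π : MvPolynomial ι k →ₐ[k] A} (hπ : Function.Surjective π)
    (hI : I = (MvPolynomial.idealOfVars ι k).map π)
    (hker : ∀ p, π p = 0 → ∀ i, π (MvPolynomial.homogeneousComponent i p) = 0)
    (hgr : ∀ i p, p.IsHomogeneous i → π p ∈ I ^ (i + 1) → π p = 0) :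
    Nonempty (A ≃ₐ[k] AssocGraded I) := by
  have hX : ∀ i, π (MvPolynomial.X i) ∈ I := fun i => by
    rw [hI]
    exact Ideal.mem_map_of_mem _ (Ideal.subset_span ⟨i, rfl⟩)
  set Θ : MvPolynomial ι k →ₐ[k] AssocGraded I :=
    (Ideal.Quotient.mkₐ k (I.map (algebraMap A (reesAlgebra I)))).comp (toRees I π hX) with hΘ
  have hsurj : Function.Surjective Θ := by
    intro y
    obtain ⟨x, rfl⟩ := Ideal.Quotient.mk_surjective y
    have key : ∀ i (a : A) (ha : a ∈ I ^ i), ∃ p, Θ p = Ideal.Quotient.mk _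
        (⟨Polynomial.monomial i a, reesAlgebra.monomial_mem.2 ha⟩ : reesAlgebra I) := by
      intro i a ha
      have ha' := ha
      rw [hI, ← Ideal.map_pow, Ideal.mem_map_iff_of_surjective _ hπ] at ha'
      obtain ⟨q, hq, rfl⟩ := ha'
      have hq' : q - MvPolynomial.homogeneousComponent i q ∈
          MvPolynomial.idealOfVars ι k ^ (i + 1) := by
        rw [MvPolynomial.mem_pow_idealOfVars_iff'] at hq ⊢
        intro x hx
        rw [MvPolynomial.coeff_sub, MvPolynomial.coeff_homogeneousComponent]
        split_ifs with h
        · exact sub_self _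
        · rw [hq x (by omega), sub_zero]
      refine ⟨MvPolynomial.homogeneousComponent i q, ?_⟩
      rw [eq_comm, hΘ, AlgHom.comp_apply, Ideal.Quotient.mkₐ_eq_mk, Ideal.Quotient.eq]
      have hmem : π (q - MvPolynomial.homogeneousComponent i q) ∈ I ^ (i + 1) := by
        rw [hI, ← Ideal.map_pow]
        exact Ideal.mem_map_of_mem _ hq'
      convert monomial_mem_map_reesAlgebra hmem
        (reesAlgebra.monomial_mem.2 (Ideal.pow_le_pow_right (Nat.le_succ i) hmem)) using 1
      ext j
      rw [Subalgebra.coe_sub, Polynomial.coeff_sub, coeff_toRees, Polynomial.coeff_monomial,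
        Polynomial.coeff_monomial, MvPolynomial.homogeneousComponent_of_mem
        (MvPolynomial.homogeneousComponent_mem i q)]
      by_cases hij : i = j
      · subst hij
        simp
      · rw [if_neg hij, if_neg hij, if_neg (Ne.symm hij), map_zero, sub_zero]
    choose p hp using key
    refine ⟨∑ i ∈ (x : Polynomial A).support, p i _ (x.2 i), ?_⟩
    rw [map_sum]
    simp only [hp]
    rw [← map_sum]
    congr 1
    apply Subtype.ext
    rw [AddSubmonoidClass.coe_finsetSum]
    exact (Polynomial.as_sum_support _).symm
  have hk : RingHom.ker π = RingHom.ker Θ := by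
    ext p
    rw [RingHom.mem_ker, RingHom.mem_ker]
    constructor
    · intro hp
      have : toRees I π hX p = 0 := by
        apply Subtype.ext
        ext i
        rw [coeff_toRees, hker p hp]
        simp
      rw [hΘ, AlgHom.comp_apply, this, map_zero]
    · intro hp
      have h1 := Ideal.Quotient.eq_zero_iff_mem.1 hp
      rw [← MvPolynomial.sum_homogeneousComponent p, map_sum]
      refine Finset.sum_eq_zero fun i _ => hgr i _
        (MvPolynomial.homogeneousComponent_isHomogeneous i p) ?_
      rw [← coeff_toRees I π hX]
      exact coeff_mem_of_mem_map_reesAlgebra h1 i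
  exact ⟨(Ideal.quotientKerAlgEquivOfSurjective hπ).symm.trans
    ((Ideal.quotientEquivAlgOfEq k hk).trans (Ideal.quotientKerAlgEquivOfSurjective hsurj))⟩

/-- In degree `d`, testing a component of `σ` against `τ` amounts to testing `σ` against a component
of `τ`. Hence the apolar ideal of a homogeneous functional is homogeneous. -/
theorem homogeneousComponent_mul_homogeneousComponent {k : Type*} [Field k] {n i d : ℕ}
    (hi : i ≤ d) (σ τ : PS k n) :
    homogeneousComponent d (τ * homogeneousComponent i σ) =
      homogeneousComponent d (homogeneousComponent (d - i) τ * σ) := by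
  classical
  ext a
  rw [coeff_homogeneousComponent, coeff_homogeneousComponent]
  split_ifs with ha
  · rw [coeff_mul, coeff_mul]
    refine Finset.sum_congr rfl fun x hx => ?_
    rw [Finset.HasAntidiagonal.mem_antidiagonal] at hx
    have hdeg : x.1.degree + x.2.degree = d := by rw [← ha, ← hx, map_add]
    rw [coeff_homogeneousComponent, coeff_homogeneousComponent]
    by_cases h : x.2.degree = i
    · rw [if_pos h, if_pos (by omega)]
    · rw [if_neg h, if_neg (by omega), mul_zero, zero_mul]
  · rfl

theorem homogeneousComponent_mem_apolarIdeal {k : Type*} [Field k] {n d : ℕ}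
    {f : Module.Dual k (PS k n)} {σ : PS k n} (hσ : σ ∈ apolarIdeal (homPart d f)) (i : ℕ) :
    homogeneousComponent i σ ∈ apolarIdeal (homPart d f) := by
  rw [mem_apolarIdeal] at hσ ⊢
  intro τ
  rcases le_or_gt i d with hi | hi
  · have := hσ (homogeneousComponent (d - i) τ)
    rwa [homPart, LinearMap.comp_apply, ← homogeneousComponent_mul_homogeneousComponent hi]
      at this
  · refine mem_vanishing.1 (homPart_mem_vanishing d f) _ (Ideal.mul_mem_left _ _ ?_)
    rw [mem_maxIdeal_pow_iff]
    intro a ha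
    rw [coeff_homogeneousComponent, if_neg (by omega)]

theorem maxIdeal_eq_span (k : Type*) [Field k] (n : ℕ) :
    maxIdeal k n = Ideal.span (Set.range fun i => (X i : PS k n)) := by
  apply le_antisymm
  · intro σ hσ
    rw [← sum_X_mul_divVar (mem_maxIdeal_iff.1 hσ)]
    exact Ideal.sum_mem _ fun i _ => Ideal.mul_mem_right _ _ (Ideal.subset_span ⟨i, rfl⟩)
  · rw [Ideal.span_le]
    rintro _ ⟨i, rfl⟩
    exact X_mem_maxIdeal k i

theorem coe_homogeneousComponent {k : Type*} [Field k] {n : ℕ} (i : ℕ)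
    (p : MvPolynomial (Fin n) k) :
    ((MvPolynomial.homogeneousComponent i p : MvPolynomial (Fin n) k) : PS k n) =
      homogeneousComponent i (p : PS k n) := by
  ext a
  rw [MvPolynomial.coeff_coe, MvPolynomial.coeff_homogeneousComponent, coeff_homogeneousComponent,
    MvPolynomial.coeff_coe]

theorem isCanonicallyGraded_of_ker {k A : Type*} [Field k] [CommRing A] [Algebra k A]
    [IsLocalRing A] {n d : ℕ} {f : Module.Dual k (PS k n)} {ρ : PS k n →ₐ[k] A}
    (hρ : Function.Surjective ρ) (hker : ∀ σ, ρ σ = 0 ↔ σ ∈ apolarIdeal (homPart d f)) :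
    IsCanonicallyGraded k A := by
  let c : MvPolynomial (Fin n) k →ₐ[k] PS k n :=
    { MvPolynomial.coeToMvPowerSeries.ringHom with
      commutes' := fun r => by
        show ((MvPolynomial.C r : MvPolynomial (Fin n) k) : PS k n) = _
        rw [MvPolynomial.coe_C, MvPowerSeries.algebraMap_apply]
        rfl }
  have hc : ∀ p, c p = (p : PS k n) := fun _ => rfl
  have hm : IsLocalRing.maximalIdeal A = (maxIdeal k n).map ρ :=
    (IsLocalRing.map_maximalIdeal_of_surjective (ρ : PS k n →+* A) hρ).symm
  have hbig : ∀ σ ∈ maxIdeal k n ^ (d + 1), ρ σ = 0 := fun σ hσ =>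
    (hker σ).2 (mem_apolarIdeal.2 fun τ =>
      mem_vanishing.1 (homPart_mem_vanishing d f) _ (Ideal.mul_mem_left _ _ hσ))
  refine ⟨inferInstance, nonempty_algEquiv_assocGraded (π := ρ.comp c) ?_ ?_ ?_ ?_⟩
  · intro a
    obtain ⟨σ, rfl⟩ := hρ a
    refine ⟨truncTotal (d + 1) σ, ?_⟩
    have := hbig _ (sub_truncTotal_mem σ (d + 1))
    rw [map_sub, sub_eq_zero] at this
    exact this.symm
  · rw [hm, maxIdeal_eq_span, MvPolynomial.idealOfVars, Ideal.map_span, Ideal.map_span,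
      ← Set.range_comp, ← Set.range_comp]
    congr 2
    ext i
    simp [hc]
  · intro p hp i
    rw [AlgHom.comp_apply, hc, hker] at hp ⊢
    rw [coe_homogeneousComponent]
    exact homogeneousComponent_mem_apolarIdeal hp i
  · intro i p hp hmem
    rw [hm, ← Ideal.map_pow, Ideal.mem_map_iff_of_surjective _ hρ] at hmem
    obtain ⟨s, hs, hsp⟩ := hmem
    rw [AlgHom.comp_apply, hc] at hsp ⊢
    -- The lift `s` has no term of degree `i`, so the degree `i` component of `p - s` is `p` itself.
    have h1 : (p : PS k n) - s ∈ apolarIdeal (homPart d f) := by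
      rw [← hker, map_sub, hsp, sub_self]
    have h2 := homogeneousComponent_mem_apolarIdeal h1 i
    have h3 : homogeneousComponent i s = 0 := by
      ext a
      rw [coeff_homogeneousComponent]
      split_ifs with h
      · rw [mem_maxIdeal_pow_iff.1 hs a (by omega), map_zero]
      · simp
    rw [map_sub, h3, sub_zero, ← coe_homogeneousComponent,
      MvPolynomial.homogeneousComponent_of_mem ((MvPolynomial.mem_homogeneousSubmodule _ _).2 hp),
      if_pos rfl] at h2
    exact (hker _).2 h2

/-! ### Apolar cubics and the open set U -/

/-- The binary cubic form with coefficients `c`. -/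
noncomputable def cubicForm {k : Type*} [Field k] (c : Fin 4 → k) : PS k 2 :=
  ∑ l, c l • mon k (3 - l) l

theorem coeff_cubicForm {k : Type*} [Field k] (c : Fin 4 → k) (l : Fin 4) :
    coeff (bideg (3 - l) l) (cubicForm c) = c l := by
  rw [cubicForm, map_sum, Finset.sum_eq_single l]
  · simp [coeff_bideg_mon]
  · intro j _ hj
    rw [coeff_smul, coeff_bideg_mon, if_neg, mul_zero]
    exact fun h => hj (Fin.ext h.2.symm)
  · simp

theorem homogeneousComponent_cubicForm {k : Type*} [Field k] (c : Fin 4 → k) :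
    homogeneousComponent 3 (cubicForm c) = cubicForm c := by
  rw [cubicForm, map_sum]
  refine Finset.sum_congr rfl fun l _ => ?_
  rw [map_smul, homogeneousComponent_mon (by omega)]

theorem homogeneousComponent_mem_maxIdeal_pow {k : Type*} [Field k] {n : ℕ} (d : ℕ) (σ : PS k n) :
    homogeneousComponent d σ ∈ maxIdeal k n ^ d := by
  rw [mem_maxIdeal_pow_iff]
  intro a ha
  rw [coeff_homogeneousComponent, if_neg ha.ne]

/-- Only degree 5 products count, so a cubic is tested against the three quadratic monomials, one
for each row of the Hankel matrix. -/
theorem cubicForm_mem_apolarIdeal_iff {k : Type*} [Field k] {f : Module.Dual k (PS k 2)}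
    (hf : f ∈ vanishing k 2 6) (c : Fin 4 → k) :
    cubicForm c ∈ apolarIdeal (homPart 5 f) ↔ HankelKer (quinticCoeff f) c := by
  have hF := homPart_mem_vanishing 5 f
  have h3 : cubicForm c ∈ maxIdeal k 2 ^ 3 := by
    rw [← homogeneousComponent_cubicForm]
    exact homogeneousComponent_mem_maxIdeal_pow 3 _
  have key : ∀ v < 3, homPart 5 f (mon k (2 - v) v * cubicForm c) =
      c 0 * quinticCoeff f v + c 1 * quinticCoeff f (v + 1) + c 2 * quinticCoeff f (v + 2) +
        c 3 * quinticCoeff f (v + 3) := by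
    intro v hv
    rw [apply_mon_mul hF (by omega) h3, Finset.sum_range, quinticCoeff_homPart hf]
    simp only [coeff_cubicForm]
    simp [Fin.sum_univ_four, add_comm v]
  rw [mem_apolarIdeal]
  constructor
  · intro h v hv
    rw [← key v hv]
    exact h _
  · intro h τ
    have e1 : homPart 5 f (τ * cubicForm c) =
        homPart 5 f (homogeneousComponent 2 τ * cubicForm c) := by
      rw [homPart, LinearMap.comp_apply, LinearMap.comp_apply]
      conv_lhs => rw [← homogeneousComponent_cubicForm]
      rw [homogeneousComponent_mul_homogeneousComponent (by norm_num)]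
    have e2 := Ideal.mul_mem_mul
      (sub_sum_mon_mem (homogeneousComponent_mem_maxIdeal_pow 2 τ)) h3
    rw [← pow_add] at e2
    have e3 := mem_vanishing.1 hF _ e2
    rw [sub_mul, map_sub, sub_eq_zero] at e3
    rw [e1, e3, Finset.sum_mul, map_sum]
    refine Finset.sum_eq_zero fun v hv => ?_
    have hv' : v < 3 := by simpa using hv
    rw [smul_mul_assoc, map_smul, key v hv', h v hv', smul_zero]

theorem sum_smul_X_pow_three {k : Type*} [Field k] (v : Fin 2 → k) :
    (∑ i, v i • (X i : PS k 2)) ^ 3 = cubicForm (cubeCoeff (v 0) (v 1)) := by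
  rw [Fin.sum_univ_two, cubicForm, Fin.sum_univ_four]
  simp only [cubeCoeff, mon_eq_pow, Algebra.smul_def, Matrix.cons_val, map_mul, map_pow,
    Fin.val_zero, Fin.val_one, Fin.val_two, map_ofNat]
  norm_num
  ring

theorem cubicForm_injective {k : Type*} [Field k] :
    Function.Injective (cubicForm : (Fin 4 → k) → PS k 2) := fun c d h =>
  funext fun l => by rw [← coeff_cubicForm c, h, coeff_cubicForm]

theorem cubicForm_zero {k : Type*} [Field k] : cubicForm (0 : Fin 4 → k) = 0 := by
  simp [cubicForm]

theorem cubicNotPower_of_hessian {k : Type*} [Field k] {f : Module.Dual k (PS k 2)}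
    (hf : f ∈ vanishing k 2 6) (h : hessian (apolarCubic (quinticCoeff f)) ≠ 0) :
    CubicNotPower (homPart 5 f) := by
  rintro _ hc hne - v rfl
  rw [sum_smul_X_pow_three] at hc hne
  obtain ⟨t, ht⟩ := ((cubicForm_mem_apolarIdeal_iff hf _).1 hc).exists_eq_smul
    (apolarCubic_ne_zero_of_hessian h)
  have h1 := hessian_cubeCoeff (v 0) (v 1)
  rw [ht, hessian_smul, smul_eq_zero, or_iff_left h] at h1
  rw [ht, pow_eq_zero_iff two_ne_zero |>.1 h1, zero_smul, cubicForm_zero] at hne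
  exact hne rfl

theorem hessian_ne_zero_of_cubicNotPower {k : Type*} [Field k] [IsAlgClosed k]
    (h3 : (3 : k) ≠ 0) {f : Module.Dual k (PS k 2)} (hf : f ∈ vanishing k 2 6)
    (hq : NoQuadric (quinticCoeff f)) (hc : CubicNotPower (homPart 5 f)) :
    hessian (apolarCubic (quinticCoeff f)) ≠ 0 := by
  intro h
  obtain ⟨a, b, hab⟩ := exists_eq_cubeCoeff h3 h
  refine hc (cubicForm (apolarCubic (quinticCoeff f)))
    ((cubicForm_mem_apolarIdeal_iff hf _).2 (hankelKer_apolarCubic _)) ?_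
    (homogeneousComponent_cubicForm _) ![a, b] ?_
  · rw [← cubicForm_zero]
    exact fun h0 => apolarCubic_ne_zero_of_noQuadric hq (cubicForm_injective h0)
  · rw [sum_smul_X_pow_three, hab]
    rfl

theorem hasHilbertFunction_and_cubicNotPower_iff {k : Type*} [Field k] [IsAlgClosed k]
    (h3 : (3 : k) ≠ 0) {f : Module.Dual k (PS k 2)} (hf : f ∈ vanishing k 2 6) :
    hessian (apolarCubic (quinticCoeff f)) ≠ 0 ↔
      HasHilbertFunction k (Apolar f) h123321 ∧ CubicNotPower (homPart 5 f) :=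
  ⟨fun h => ⟨(noQuadric_of_apolarCubic_ne_zero
      (apolarCubic_ne_zero_of_hessian h)).hasHilbertFunction hf, cubicNotPower_of_hessian hf h⟩,
    fun h => hessian_ne_zero_of_cubicNotPower h3 hf
      (noQuadric_of_hasHilbertFunction hf h.1) h.2⟩

theorem map_hessian_apolarCubic {R R' : Type*} [CommRing R] [CommRing R'] (φ : R →+* R')
    (w : ℕ → R) (i : Fin 3) :
    φ (hessian (apolarCubic w) i) = hessian (apolarCubic fun l => φ (w l)) i := by
  have h3 : φ 3 = 3 := map_ofNat φ 3
  have h9 : φ 9 = 9 := map_ofNat φ 9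
  fin_cases i <;> simp [hessian, apolarCubic, hankelDet, h3, h9]

theorem isZariskiOpen_hessian_ne_zero (k : Type*) [Field k] :
    IsZariskiOpen {f : dpLE k 2 5 | hessian (apolarCubic (quinticCoeff f.1)) ≠ 0} := by
  -- Coefficients of the generic quintic. For `l > 5` the truncated `5 - l` is 0 and the monomial
  -- has degree `l > 5`, where `f` vanishes.
  let W : ℕ → MvPolynomial {a : Fin 2 →₀ ℕ // a.degree ≤ 5} k := fun l =>
    if h : 5 - l + l ≤ 5 then MvPolynomial.X ⟨bideg (5 - l) l, by rwa [degree_bideg]⟩ else 0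
  refine ⟨Ideal.span (Set.range (hessian (apolarCubic W))), fun f => ?_⟩
  have hf := (dpLE_eq_vanishing k 2 5).le f.2
  have hW : ∀ l, MvPolynomial.aeval (fun a : {a : Fin 2 →₀ ℕ // a.degree ≤ 5} =>
      f.1 (monomial a.1 1)) (W l) = quinticCoeff f.1 l := by
    intro l
    simp only [W]
    split_ifs with h
    · rw [MvPolynomial.aeval_X]
      rfl
    · rw [map_zero]
      exact (mem_vanishing.1 hf _ (mon_mem k (by omega))).symm
  rw [MvPolynomial.zeroLocus_span, Set.mem_ofPred_eq, not_iff_not, Set.mem_ofPred_eq,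
    Set.forall_mem_range, funext_iff]
  refine forall_congr' fun i => ?_
  have := map_hessian_apolarCubic (MvPolynomial.aeval
    (fun a : {a : Fin 2 →₀ ℕ // a.degree ≤ 5} => f.1 (monomial a.1 1)) :
      MvPolynomial _ k →ₐ[k] k).toRingHom W i
  simp only [AlgHom.toRingHom_eq_coe, RingHom.coe_coe, hW] at this
  rw [this]
  rfl

theorem exists_hessian_ne_zero (k : Type*) [Field k] :
    ∃ f ∈ dpLE k 2 5, hessian (apolarCubic (quinticCoeff f)) ≠ 0 := by
  -- Here w₀ = w₄ = 1 and the other coefficients vanish. The apolar cubic is α₁²α₂, whose first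
  -- Hessian coefficient is -1 in every characteristic.
  refine ⟨dpMonomial k (bideg 5 0) + dpMonomial k (bideg 1 4), Submodule.add_mem _
    (Submodule.subset_span ⟨_, by simp [degree_bideg], rfl⟩)
    (Submodule.subset_span ⟨_, by simp [degree_bideg], rfl⟩), fun h => ?_⟩
  have := congrFun h 0
  simp [hessian, apolarCubic, hankelDet, quinticCoeff, dpMonomial, coeff_bideg_mon] at this

theorem notMem_dpLE_four_of_hessian {k : Type*} [Field k] {f : Module.Dual k (PS k 2)}
    (h : hessian (apolarCubic (quinticCoeff f)) ≠ 0) : f ∉ dpLE k 2 4 := by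
  intro hf
  rw [dpLE_eq_vanishing] at hf
  have hz : quinticCoeff f = 0 := funext fun l => mem_vanishing.1 hf _ (mon_mem k (by omega))
  apply apolarCubic_ne_zero_of_hessian h
  rw [hz]
  ext i
  fin_cases i <;> simp [apolarCubic, hankelDet]

/-- Functionals in the same orbit have isomorphic apolar algebras, and these are canonically graded
if the orbit contains a homogeneous functional. -/
theorem apolar_of_mem_gPlusOrbit {k : Type*} [Field k] {n d : ℕ} {f g : Module.Dual k (PS k n)}
    (hf : f ∈ gPlusOrbit (homPart d g)) [IsLocalRing (Apolar f)] :
    Nonempty (Apolar f ≃ₐ[k] Apolar (homPart d g)) ∧ IsCanonicallyGraded k (Apolar f) := by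
  obtain ⟨L, hL, rfl⟩ := hf
  obtain ⟨φ, hφ⟩ := exists_apolarIdeal_eq_comap hL
  replace hφ := hφ (homPart d g)
  constructor
  · refine ⟨Ideal.quotientEquivAlg _ _ φ ?_⟩
    ext σ
    rw [Ideal.mem_map_iff_of_surjective (φ : PS k n →+* PS k n) φ.surjective]
    constructor
    · exact fun h => ⟨φ.symm σ, (hφ _).2 (by rwa [φ.apply_symm_apply]), φ.apply_symm_apply σ⟩
    · rintro ⟨τ, hτ, rfl⟩
      exact (hφ τ).1 hτ
  -- Precomposing the quotient map with φ⁻¹ gives a surjection onto the same algebra whose kernel is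
  -- the homogeneous apolar ideal.
  · refine isCanonicallyGraded_of_ker (f := g) (d := d)
      (ρ := (Ideal.Quotient.mkₐ k _).comp (φ.symm : PS k n →ₐ[k] PS k n))
      ((Ideal.Quotient.mkₐ_surjective k _).comp φ.symm.surjective) fun σ => ?_
    rw [AlgHom.comp_apply, Ideal.Quotient.mkₐ_eq_mk, Ideal.Quotient.eq_zero_iff_mem]
    refine (hφ _).trans ?_
    rw [AlgEquiv.coe_toAlgHom, φ.apply_symm_apply]

end Macaulay

/-! ### The main theorem -/

theorem mainTheorem11 (k : Type*) [Field k] [IsAlgClosed k]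
    (hchar : ringChar k = 0 ∨ 5 < ringChar k) :
    ∃ U : Set (Macaulay.dpLE k 2 5),
      Macaulay.IsZariskiOpen U ∧ U.Nonempty ∧
      (∀ f : Macaulay.dpLE k 2 5, f ∈ U ↔
        Macaulay.HasHilbertFunction k (Macaulay.Apolar f.1) Macaulay.h123321 ∧
        Macaulay.CubicNotPower (Macaulay.homPart 5 f.1)) ∧
      ∀ f ∈ U,
        f.1 ∉ Macaulay.dpLE k 2 4 ∧
        Macaulay.HasHilbertFunction k (Macaulay.Apolar f.1) Macaulay.h123321 ∧
        Macaulay.HasHilbertFunction k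
          (Macaulay.Apolar (Macaulay.homPart 5 f.1)) Macaulay.h123321 ∧
        Macaulay.gPlusOrbit (Macaulay.homPart 5 f.1) =
          {g | g - Macaulay.homPart 5 f.1 ∈ Macaulay.dpLE k 2 4} ∧
        Nonempty (Macaulay.Apolar f.1 ≃ₐ[k] Macaulay.Apolar (Macaulay.homPart 5 f.1)) ∧
        Macaulay.IsCanonicallyGraded k (Macaulay.Apolar f.1) := by
  have hne : ∀ m : ℕ, m ≠ 0 → m ≤ 5 → (m : k) ≠ 0 := by
    intro m hm hm5 h
    have hd := (ringChar.spec k m).1 h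
    rcases hchar with h0 | h5
    · rw [h0, zero_dvd_iff] at hd
      exact hm hd
    · have := Nat.le_of_dvd (Nat.pos_of_ne_zero hm) hd
      omega
  have h2 : (2 : k) ≠ 0 := by exact_mod_cast hne 2 (by norm_num) (by norm_num)
  have h3 : (3 : k) ≠ 0 := by exact_mod_cast hne 3 (by norm_num) (by norm_num)
  have hv : ∀ f : Macaulay.dpLE k 2 5, f.1 ∈ Macaulay.vanishing k 2 6 := fun f =>
    (Macaulay.dpLE_eq_vanishing k 2 5).le f.2
  refine ⟨_, Macaulay.isZariskiOpen_hessian_ne_zero k, ?_,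
    fun f => Macaulay.hasHilbertFunction_and_cubicNotPower_iff h3 (hv f), fun f hf => ?_⟩
  · obtain ⟨f, hf, h⟩ := Macaulay.exists_hessian_ne_zero k
    exact ⟨⟨f, hf⟩, h⟩
  · have hq := Macaulay.noQuadric_of_apolarCubic_ne_zero
      (Macaulay.apolarCubic_ne_zero_of_hessian hf)
    have hcoeff := Macaulay.quinticCoeff_homPart (hv f)
    have hF := Macaulay.homPart_mem_vanishing 5 f.1
    have hH := hq.hasHilbertFunction (hv f)
    -- The orbit theorem is applied to f_5, which has the same quintic coefficients as `f`.
    have horb := Macaulay.gPlusOrbit_eq h2 h3 hF (by rw [hcoeff]; exact hf)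
    have hmem : f.1 ∈ Macaulay.gPlusOrbit (Macaulay.homPart 5 f.1) := by
      rw [horb]
      exact Macaulay.sub_homPart_mem_vanishing (hv f)
    have hloc : IsLocalRing (Macaulay.Apolar f.1) := hH.1
    refine ⟨Macaulay.notMem_dpLE_four_of_hessian hf, hH,
      Macaulay.NoQuadric.hasHilbertFunction hF (by rwa [hcoeff]), ?_,
      Macaulay.apolar_of_mem_gPlusOrbit hmem⟩
    rw [horb, ← Macaulay.dpLE_eq_vanishing k 2 4]
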